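/- Let $\mathbb K$ be a field of characteristic zero and let $(m_n)_{n\ge 1}$ be a sequence in $\mathbb K$ (the moments $m_n=\varphi(a^n)$ of a random variable). Let the classical cumulants $(c_n)_{n\ge1}$ and the free cumulants $(k_n)_{n\ge1}$ be defined by $$\sum_{n\ge1}c_n\frac{z^n}{n!}=\log\Bigl(1+\sum_{n\ge1}m_n\frac{z^n}{n!}\Bigr),\qquad M(z)=1+K(zM(z)),\quad M(z)=1+\sum_{n\ge1}m_nz^n,\ K(z)=\sum_{n\ge1}k_nz^n .$$ For a set partition $P$ of $[n]=\{1,\dots,n\}$ put $c_P=\prod_{\pi\in P}c_{|\pi|}$ and $k_P=\prod_{\pi\in P}k_{|\pi|}$. Let $\mathrm{SP}(n)$ and $\mathrm{NCP}(n)$ be the sets of all, respectively of all noncrossing, set partitions of $[n]$, and let $\mathrm{nc}(P)$ be the noncrossing closure of $P$, i.e. the finest noncrossing partition that is coarser than $P$. Let $\mathcal H_{\mathrm{SP}}$ (resp. $\mathcal H_{\mathrm{NCP}}$) be the free associative $\mathbb K$-algebra on the set of all (resp. all noncrossing) partitions of the sets $[n]$, $n\ge1$. Its monomials $w=P_1\cdots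 P_r$, called multipartitions, form a basis; the empty partition is identified with the unit $1$. For blocks $\pi,\rho$ of a partition write $\pi\to\rho$ if the interval $[\min\pi,\max\pi]$ meets $\rho$. A cut $(L,U)$ of a partition $P$ is a splitting of its set of blocks into two complementary parts such that $\pi\to\rho$ and $\rho\in L$ imply $\pi\in L$. A cut of $P_1\cdots P_r$ is a family of cuts $(L_i,U_i)$ of the $P_i$. For such a cut let $L$ also denote the monomial $L_1\cdots L_r$ of standardized partitions, and let $[U]$ denote the product, for $i=1,\dots,r$ in order, of the standardized restrictions of $P_i$ to the successive nonempty gaps (before, between and after) left by the points of $L_i$. For a multipartition $w\neq1$ put $$\Delta_\prec(w)=\sum_{(L,U)\text{ cut of }w,\ 1\in L}L\otimes[U],$$ where $1\in L$ means that the first element of $P_1$ lies in a block of $L_1$, and put $\Delta_\prec(1)=0$. For linear forms $f,g$ put $f\prec g=m_{\mathbb K}\circ(f\otimes g)\circ\Delta_\prec$, where $m_{\mathbb K}$ is the multiplication of $\mathbb K$. Let $\varepsilon$ denote the counit, which is $1$ on the unit and $0$ on all other multipartitions. Let $\mathrm{nc}^*:\mathcal H_{\mathrm{NCP}}\to\mathcal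 H_{\mathrm{SP}}$ be the algebra morphism with $\mathrm{nc}^*(Q)=\sum_{\mathrm{nc}(P)=Q}P$ for noncrossing partitions $Q$. Let $\kappa$ be the linear form on $\mathcal H_{\mathrm{NCP}}$ with value $k_n$ on the one-block partition $\{[n]\}$ for each $n\ge1$ and $0$ on all other multipartitions. Let $\gamma$ be the linear form on $\mathcal H_{\mathrm{SP}}$ with $\gamma(P)=c_P$ for every partition $P$ of some $[n]$, $n\ge1$, such that $\mathrm{nc}(P)=\{[n]\}$, and $0$ on all other multipartitions. **Proposition.** The equation $\phi=\varepsilon+\kappa\prec\phi$ has a unique solution $\phi$ among the linear forms on $\mathcal H_{\mathrm{NCP}}$, the equation $\psi=\varepsilon+\gamma\prec\psi$ has a unique solution $\psi$ among the linear forms on $\mathcal H_{\mathrm{SP}}$, and $$\phi=\psi\circ\mathrm{nc}^* .$$ Moreover, $\phi(Q)=k_Q$ for every noncrossing partition $Q$ and $\psi(P)=c_P$ for every partition $P$ of some $[n]$, $n\ge 1$. Hence on partitions the identity specializes to $k_Q=\sum_{\mathrm{nc}(P)=Q}c_P$, i.e. $k=c\circ\mathrm{nc}^*$. Finally, $m_n=\sum_{P\in\mathrm{SP}(n)}\psi(P)$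 for every $n\ge1$. -/

import Mathlib

open scoped TensorProduct

noncomputable section

namespace GapInsertion

/-! ## Set partitions -/

/-- A (standard) set partition of degree `n`: an equivalence relation on an `n`-element linearly
ordered set; its blocks are the equivalence classes. The order `P ≤ Q` of `Setoid` means that `P`
is finer than `Q`, and `⊤` is, for `n ≥ 1`, the partition with the single block `[n]`. -/
abbrev SetPartition (n : ℕ) : Type := Setoid (Fin n)

instance (n : ℕ) : Finite (SetPartition n) :=
  Finite.of_injective (fun P : SetPartition n => (P : Fin n → Fin n → Prop))
    (fun P Q h => Setoid.ext fun a b => iff_of_eq (congrFun (congrFun h a) b))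

instance (n : ℕ) : Fintype (SetPartition n) := Fintype.ofFinite _

/-- No two distinct blocks cross: there are no `a < c < b < d` with `a, b` in one block
and `c, d` in a different one. -/
def IsNoncrossing {n : ℕ} (P : SetPartition n) : Prop :=
  ∀ a b c d : Fin n, a < c → c < b → b < d → P a b → P c d → P a c

/-- The noncrossing closure: the finest noncrossing partition that is coarser than `P`. -/
def nc {n : ℕ} (P : SetPartition n) : SetPartition n :=
  sInf {Q | IsNoncrossing Q ∧ P ≤ Q}

theorem nc_isLeast {n : ℕ} (P : SetPartition n) :
    IsLeast {Q : SetPartition n | IsNoncrossing Q ∧ P ≤ Q} (nc P) := by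
  refine ⟨⟨?_, ?_⟩, fun Q hQ => sInf_le hQ⟩
  · intro a b c d h1 h2 h3 hab hcd Q hQ
    exact hQ.1 a b c d h1 h2 h3 (hab Q hQ) (hcd Q hQ)
  · exact le_sInf fun Q hQ => hQ.2

/-- The restriction of `P` to the subset `X`, standardized along the unique monotone bijection
of `X` with `{0, …, |X| - 1}`. -/
def restrict {n : ℕ} (P : SetPartition n) (X : Finset (Fin n)) : SetPartition X.card :=
  Setoid.comap (X.orderEmbOfFin rfl) P

/-- A class of set partitions that is stable under restriction to subsets. -/
structure PartitionClass where
  Mem : ∀ {n : ℕ}, SetPartition n → Prop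
  restrict_mem : ∀ {n : ℕ} (P : SetPartition n) (X : Finset (Fin n)), Mem P → Mem (restrict P X)

/-- The class of all set partitions. -/
def SP : PartitionClass where
  Mem _ := True
  restrict_mem _ _ _ := trivial

/-- The class of all noncrossing set partitions. -/
def NCP : PartitionClass where
  Mem P := IsNoncrossing P
  restrict_mem P X hP := by
    intro a b c d h1 h2 h3 hab hcd
    exact hP _ _ _ _ ((X.orderEmbOfFin rfl).lt_iff_lt.2 h1)
      ((X.orderEmbOfFin rfl).lt_iff_lt.2 h2) ((X.orderEmbOfFin rfl).lt_iff_lt.2 h3) hab hcd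

/-- A nonempty partition (of some degree `n ≥ 1`) of the class `F`. -/
structure NonemptyPartition (F : PartitionClass) where
  deg : ℕ
  deg_pos : 0 < deg
  part : SetPartition deg
  mem : F.Mem part

/-- Multipartitions of the class `F`: (noncommutative) monomials in nonempty partitions. -/
abbrev Multipartition (F : PartitionClass) : Type := FreeMonoid (NonemptyPartition F)

/-- The standardized restriction `P|X` as a multipartition; the empty partition is identified
with the unit. -/
def restrictMonomial {F : PartitionClass} (P : NonemptyPartition F) (X : Finset (Fin P.deg)) :
    Multipartition F :=
  open Classical in
  if h : X.Nonempty then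
    FreeMonoid.of ⟨X.card, X.card_pos.2 h, restrict P.part X, F.restrict_mem _ _ P.mem⟩
  else 1

/-! ## Cuts -/

/-- The relation `π → ρ` on blocks, for `π` the block of `x` and `ρ` the block of `y`: the convex
hull of `π` meets `ρ`. -/
def Encloses {n : ℕ} (P : SetPartition n) (x y : Fin n) : Prop :=
  ∃ a b c : Fin n, P a x ∧ P b x ∧ P c y ∧ a ≤ c ∧ c ≤ b

/-- `X` is (the underlying set of) a lowerset `L` of blocks of `P`: if a block is in `L`, then so
are all blocks enclosing or crossing it. In particular `X` is a union of blocks, because a block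
encloses itself. The complementary set of blocks is then an upperset, so that lowersets are the
same as cuts `(L, U)`. -/
def IsLowerset {n : ℕ} (P : SetPartition n) (X : Finset (Fin n)) : Prop :=
  ∀ x y : Fin n, Encloses P x y → y ∈ X → x ∈ X

/-- All lowersets of `P`, equivalently all cuts of `P`. -/
def lowersets {n : ℕ} (P : SetPartition n) : Finset (Finset (Fin n)) :=
  open Classical in Finset.univ.filter (IsLowerset P)

/-- For `X = {x₁ < … < x_k}`, the `i`-th gap `D_i` of `X` (`0 ≤ i ≤ k`): the points strictly between
`x_i` and `x_{i+1}`, without lower (upper) bound if `i = 0` (`i = k`). -/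
def gap {n : ℕ} (X : Finset (Fin n)) (i : ℕ) : Finset (Fin n) :=
  Finset.univ.filter fun y => y ∉ X ∧ (X.filter (· < y)).card = i

/-- The reduced gap monomial of the cut whose lowerset has underlying set `X`: the product over the
gaps `D_0, …, D_k`, in this order, of the restrictions `P|D_i`, where empty ones are omitted. -/
def gapMonomial {F : PartitionClass} (P : NonemptyPartition F) (X : Finset (Fin P.deg)) :
    Multipartition F :=
  ((List.range (X.card + 1)).map fun i => restrictMonomial P (gap X i)).prod

/-! Cuts extend multiplicatively to multipartitions `w = P₁ ⋯ P_k`. -/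

/-- A cut of `w = P₁ ⋯ P_k` is a family consisting of a cut of each `P_i`. -/
def cuts {F : PartitionClass} (w : Multipartition F) :
    Finset (∀ i : Fin w.toList.length, Finset (Fin (w.toList.get i).deg)) :=
  Fintype.piFinset fun i => lowersets (w.toList.get i).part

/-- The lowerset monomial `L = L₁ ⋯ L_k` of a cut of `w`. -/
def lowerMonomial {F : PartitionClass} (w : Multipartition F)
    (X : ∀ i : Fin w.toList.length, Finset (Fin (w.toList.get i).deg)) : Multipartition F :=
  (List.ofFn fun i => restrictMonomial (w.toList.get i) (X i)).prod

/-- The reduced gap monomial of a cut of `w`: the product of those of the cuts of the `P_i`. -/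
def upperMonomial {F : PartitionClass} (w : Multipartition F)
    (X : ∀ i : Fin w.toList.length, Finset (Fin (w.toList.get i).deg)) : Multipartition F :=
  (List.ofFn fun i => gapMonomial (w.toList.get i) (X i)).prod

/-- The first element of (the underlying set of) `w`, i.e. the first element of `P₁`,
lies in the lowerset. -/
def FirstMem {F : PartitionClass} (w : Multipartition F)
    (X : ∀ i : Fin w.toList.length, Finset (Fin (w.toList.get i).deg)) : Prop :=
  ∃ h : 0 < w.toList.length,
    (⟨0, (w.toList.get ⟨0, h⟩).deg_pos⟩ : Fin (w.toList.get ⟨0, h⟩).deg) ∈ X ⟨0, h⟩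

/-! ## The Hopf algebras, half-shuffles, and fixpoint equations -/

/-- The algebra underlying the connected Hopf algebra of the class `F`: the free associative
algebra on the nonempty partitions in `F`, with the multipartitions as linear basis. -/
abbrev Hopf (K : Type*) [Field K] (F : PartitionClass) : Type _ :=
  MonoidAlgebra K (Multipartition F)

/-- The element of the basis given by a multipartition. -/
abbrev monomial (K : Type*) [Field K] {F : PartitionClass} (w : Multipartition F) : Hopf K F :=
  MonoidAlgebra.of K (Multipartition F) w

/-- The linear form with prescribed values on multipartitions. -/
def linearForm {K : Type*} [Field K] {F : PartitionClass} (f : Multipartition F → K) :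
    Module.Dual K (Hopf K F) :=
  (MonoidAlgebra.basis (Multipartition F) K).constr K f

/-- The counit: `1` on the empty multipartition and `0` on all others. -/
def counit (K : Type*) [Field K] (F : PartitionClass) : Module.Dual K (Hopf K F) :=
  open Classical in linearForm fun w => if w = 1 then 1 else 0

/-- The half-coproduct `Δ_≺(w) = ∑ L ⊗ U`, over the cuts `(L, U)` of `w` with `1 ∈ L`, where `U` is
replaced by its reduced gap monomial; it is `0` on the unit. -/
def deltaPrec (K : Type*) [Field K] (F : PartitionClass) :
    Hopf K F →ₗ[K] Hopf K F ⊗[K] Hopf K F :=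
  open Classical in
  (MonoidAlgebra.basis (Multipartition F) K).constr K fun w =>
    ∑ X ∈ (cuts w).filter (FirstMem w),
      monomial K (lowerMonomial w X) ⊗ₜ[K] monomial K (upperMonomial w X)

/-- The half-shuffle product `f ≺ g` of linear forms, dual to `Δ_≺`. -/
def prec {K : Type*} [Field K] {F : PartitionClass} (f g : Module.Dual K (Hopf K F)) :
    Module.Dual K (Hopf K F) :=
  LinearMap.mul' K K ∘ₗ TensorProduct.map f g ∘ₗ deltaPrec K F

/-- `f` solves the half-shuffle fixpoint equation `f = ε + α ≺ f`. -/
def IsFixpoint {K : Type*} [Field K] {F : PartitionClass} (α f : Module.Dual K (Hopf K F)) : Prop :=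
  f = counit K F + prec α f

/-- A nonempty partition as a generator of the algebra of all set partitions. -/
def genSP {n : ℕ} (hn : 0 < n) (P : SetPartition n) : NonemptyPartition SP :=
  ⟨n, hn, P, trivial⟩

/-- The algebra morphism `nc* : H_NCP → H_SP` with `Q ↦ ∑_{nc(P) = Q} P` on noncrossing
partitions. -/
def ncStar (K : Type*) [Field K] : Hopf K NCP →ₐ[K] Hopf K SP :=
  open Classical in
  MonoidAlgebra.lift K (Hopf K SP) (Multipartition NCP) (FreeMonoid.lift fun Q =>
    ∑ P ∈ Finset.univ.filter (fun P : SetPartition Q.deg => nc P = Q.part),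
      monomial K (FreeMonoid.of (genSP Q.deg_pos P)))

/-! ## Cumulants -/

/-- `a_P = ∏_π a_{|π|}`, the product being over the blocks `π` of `P`. -/
def blockProd {K : Type*} [Field K] (a : ℕ → K) {n : ℕ} (P : SetPartition n) : K :=
  open Classical in
  ∏ π : Quotient P, a (Finset.univ.filter fun x : Fin n => Quotient.mk P x = π).card

/-- The exponential moment series `E(z) = 1 + ∑_{n ≥ 1} m_n z^n / n!`. -/
def expMomentSeries {K : Type*} [Field K] (m : ℕ → K) : PowerSeries K :=
  PowerSeries.mk fun n => if n = 0 then 1 else m n / (n.factorial : K)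

/-- The classical cumulants `c_n` of the moments `m_n`, given by
`∑_{n ≥ 1} c_n z^n / n! = log E(z)`. -/
def classicalCumulant {K : Type*} [Field K] [CharZero K] (m : ℕ → K) (n : ℕ) : K :=
  (n.factorial : K) * PowerSeries.coeff n (PowerSeries.logOf (expMomentSeries m))

/-- The ordinary moment series `M(z) = 1 + ∑_{n ≥ 1} m_n z^n`. -/
def momentSeries {K : Type*} [Field K] (m : ℕ → K) : PowerSeries K :=
  PowerSeries.mk fun n => if n = 0 then 1 else m n

/-- `(k_n)_{n ≥ 1}` are the free cumulants of the moments `(m_n)_{n ≥ 1}`: the series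
`K(z) = ∑_{n ≥ 1} k_n z^n` satisfies `M(z) = 1 + K(z M(z))`. -/
def IsFreeCumulants {K : Type*} [Field K] (m k : ℕ → K) : Prop :=
  momentSeries m = 1 +
    (PowerSeries.mk fun n => if n = 0 then 0 else k n).subst (PowerSeries.X * momentSeries m)

/-- The linear form `κ` with `κ([n]) = k_n` and `κ = 0` on all other noncrossing
multipartitions. -/
def freeForm {K : Type*} [Field K] (k : ℕ → K) : Module.Dual K (Hopf K NCP) :=
  open Classical in
  linearForm fun w =>
    match w.toList with
    | [Q] => if Q.part = ⊤ then k Q.deg else 0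
    | _ => 0

/-- The linear form `γ` with `γ(P) = c_P` if `P` is a partition whose noncrossing closure
has a single block, and `γ = 0` on all other multipartitions. -/
def classicalForm {K : Type*} [Field K] (c : ℕ → K) : Module.Dual K (Hopf K SP) :=
  open Classical in
  linearForm fun w =>
    match w.toList with
    | [P] => if nc P.part = ⊤ then blockProd c P.part else 0
    | _ => 0

end GapInsertion

end

noncomputable section

namespace GapInsertion

/-! ## Setoids on finite types -/

section Setoids

variable {K : Type*} [Field K] {ι ι' κ : Type*}

/-! Both fixpoint equations are solved by characters. In `α ≺ f`, evaluated at a multipartition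
beginning with `P`, a cut contributes only if its lower monomial is a single partition with
one-block noncrossing closure. Since the first point lies in `L`, this forces `L` to live inside
`P`, and there it must be the class of the first point in the noncrossing closure of `P`
(`isLowerset_connected_iff`). Weights of the form `∏ a |π|` are multiplicative along every cut, so
the one surviving term is the value of the character itself (`sum_firstCuts_connectedForm`). The
upper part has fewer points, hence induction on their number gives uniqueness (`IsFixpoint.eq`). The
forms `κ` and `γ` are both instances of `connectedForm`, so one argument serves both equations.

It remains to compare two characters on generators, that is, to show `k_Q = ∑_{nc(P) = Q} c_P`. A
partition with closure `Q` amounts to an independent choice, on each block of `Q`, of a partition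
with one-block closure; thus the sum factors over the blocks (`sum_ncClosure_eq`) and only `k_n =
∑_{nc(P) = ⊤} c_P` is left. Grouping all partitions by their closures turns the classical
moment-cumulant formula into a sum over noncrossing partitions with weights `connectedSum c`. The
free formula has the same shape with weights `k`, and such sums determine their weights
(`eq_of_noncrossingSum_eq`).

The classical formula follows from the differential equation of the logarithm. The free one matches
`M = 1 + K(zM)` with the decomposition of a noncrossing partition into its first block and the gaps
of that block (`gapSum_eq_sum_coeff`). -/

theorem finite_setoid (ι : Type*) [Finite ι] : Finite (Setoid ι) :=
  Finite.of_injective (fun P : Setoid ι => (P : ι → ι → Prop))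
    (fun _ _ h => Setoid.ext fun a b => iff_of_eq (congrFun (congrFun h a) b))

/-- The finitely many equivalence relations on a finite type. -/
@[reducible] def fintypeSetoid (ι : Type*) [Finite ι] : Fintype (Setoid ι) :=
  haveI := finite_setoid ι
  Fintype.ofFinite _

attribute [local instance] fintypeSetoid

/-- The product of `a |π|` over the classes `π` of an equivalence relation. -/
def classProd (a : ℕ → K) (P : Setoid ι) : K :=
  ∏ᶠ π : Quotient P, a (Nat.card {x // Quotient.mk P x = π})

/-- Passing to arbitrary index types lets restrictions live on subtypes, so that no standardization
is needed in the factorization arguments. -/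
theorem blockProd_eq_classProd (a : ℕ → K) {n : ℕ} (P : SetPartition n) :
    blockProd a P = classProd a P := by
  classical
  rw [blockProd, classProd, finprod_eq_prod_of_fintype]
  refine Finset.prod_bij (fun π _ => π) (by simp) (by simp) (by simp) fun π _ => ?_
  rw [Nat.card_eq_fintype_card, Fintype.card_subtype]

theorem classProd_comap_equiv (a : ℕ → K) (e : ι ≃ ι') (P : Setoid ι') :
    classProd a (P.comap e) = classProd a P := by
  have hmk : ∀ x y, Quotient.mk (P.comap e) x = Quotient.mk (P.comap e) y ↔
      Quotient.mk P (e x) = Quotient.mk P (e y) := fun x y => by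
    rw [Quotient.eq, Quotient.eq]; rfl
  let f : Quotient (P.comap e) → Quotient P :=
    Quotient.lift (fun x => Quotient.mk P (e x)) fun x y h => Quotient.sound h
  have hf : Function.Bijective f := by
    constructor
    · rintro ⟨x⟩ ⟨y⟩ h
      exact (hmk x y).2 h
    · rintro ⟨y⟩
      exact ⟨Quotient.mk _ (e.symm y), by simp [f]; rfl⟩
  refine finprod_eq_of_bijective f hf ?_
  rintro ⟨x⟩
  exact congrArg a (Nat.card_congr (e.subtypeEquiv fun y => hmk y x))

theorem classProd_top (a : ℕ → K) [Nonempty ι] : classProd a (⊤ : Setoid ι) = a (Nat.card ι) := by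
  obtain ⟨x⟩ := ‹Nonempty ι›
  have h : ∀ π : Quotient (⊤ : Setoid ι), π = Quotient.mk ⊤ x := by
    rintro ⟨y⟩
    exact Quotient.sound trivial
  rw [classProd, finprod_eq_single _ (Quotient.mk ⊤ x) fun π hπ => (hπ (h π)).elim]
  exact congrArg a (Nat.card_congr (Equiv.subtypeUnivEquiv fun y => h _))

theorem classProd_of_isEmpty [IsEmpty ι] (a : ℕ → K) (P : Setoid ι) : classProd a P = 1 := by
  have : IsEmpty (Quotient P) := ⟨by rintro ⟨y⟩; exact isEmptyElim y⟩
  exact finprod_of_isEmpty _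

/-- The restriction of an equivalence relation to a fiber. -/
def onFiber (P : Setoid ι) (l : ι → κ) (i : κ) : Setoid {x // l x = i} :=
  P.comap Subtype.val

/-- The equivalence relation obtained by putting together equivalence relations on the fibers. -/
def glue (l : ι → κ) (R : ∀ i, Setoid {x // l x = i}) : Setoid ι where
  r x y := ∃ h : l y = l x, R (l x) ⟨x, rfl⟩ ⟨y, h⟩
  iseqv := by
    refine ⟨fun x => ⟨rfl, (R _).refl _⟩, ?_, ?_⟩
    · rintro x y ⟨h, hR⟩
      refine ⟨h.symm, ?_⟩
      -- A free label `j` allows both points to be moved from the fiber over `l x` to the equal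
      -- fiber over `l y`.
      have : ∀ j (hj : l x = j) (hj' : l y = j), R j ⟨x, hj⟩ ⟨y, hj'⟩ → R j ⟨y, hj'⟩ ⟨x, hj⟩ :=
        fun j _ _ h => (R j).symm h
      generalize_proofs at *
      exact this (l y) _ rfl (by
        have : ∀ j (hj : l x = j) (hj' : l y = j), R j ⟨x, hj⟩ ⟨y, hj'⟩ := by
          rintro j rfl hj'; exact hR
        exact this _ _ _)
    · rintro x y z ⟨h, hR⟩ ⟨h', hR'⟩
      refine ⟨h'.trans h, (R _).trans hR ?_⟩
      have : ∀ j (hj : l y = j) (hj' : l z = j), R j ⟨y, hj⟩ ⟨z, hj'⟩ := by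
        rintro j rfl hj'; exact hR'
      exact this _ _ _

theorem glue_iff (l : ι → κ) (R : ∀ i, Setoid {x // l x = i}) {x y : ι} {i : κ} (hx : l x = i)
    (hy : l y = i) : glue l R x y ↔ R i ⟨x, hx⟩ ⟨y, hy⟩ := by
  subst hx
  exact ⟨fun ⟨_, h⟩ => h, fun h => ⟨hy, h⟩⟩

theorem glue_le (l : ι → κ) (R : ∀ i, Setoid {x // l x = i}) : glue l R ≤ Setoid.ker l :=
  fun _ _ ⟨h, _⟩ => h.symm

theorem onFiber_glue (l : ι → κ) (R : ∀ i, Setoid {x // l x = i}) (i : κ) :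
    onFiber (glue l R) l i = R i :=
  Setoid.ext fun x y => glue_iff l R x.2 y.2

theorem glue_onFiber {l : ι → κ} {P : Setoid ι} (h : P ≤ Setoid.ker l) :
    glue l (onFiber P l) = P :=
  Setoid.ext fun _ _ => ⟨fun ⟨_, hR⟩ => hR, fun hP => ⟨(h hP).symm, hP⟩⟩

/-- No class meets two fibers, so the classes of `P` are the disjoint union of the classes of its
restrictions. -/
theorem classProd_eq_prod_onFiber [Finite ι] [Fintype κ] (a : ℕ → K) {l : ι → κ} {P : Setoid ι}
    (h : P ≤ Setoid.ker l) : classProd a P = ∏ i, classProd a (onFiber P l i) := by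
  classical
  have := Fintype.ofFinite ι
  have hmk : ∀ i (x y : {x // l x = i}), Quotient.mk (onFiber P l i) x = Quotient.mk _ y ↔
      Quotient.mk P x.1 = Quotient.mk P y.1 := fun i x y => by
    rw [Quotient.eq, Quotient.eq]; rfl
  let f : (Σ i, Quotient (onFiber P l i)) → Quotient P := fun p =>
    Quotient.lift (fun x => Quotient.mk P x.1) (fun x y h => Quotient.sound h) p.2
  have hf : Function.Bijective f := by
    constructor
    · rintro ⟨i, ⟨x, rfl⟩⟩ ⟨j, ⟨y, rfl⟩⟩ hxy
      have hxy' : P x y := Quotient.exact hxy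
      have hl : l x = l y := h hxy'
      have : ∀ j (hx : l x = j) (hy : l y = j), (⟨j, Quotient.mk _ ⟨x, hx⟩⟩ :
          Σ i, Quotient (onFiber P l i)) = ⟨j, Quotient.mk _ ⟨y, hy⟩⟩ := fun j hx hy => by
        rw [(hmk j ⟨x, hx⟩ ⟨y, hy⟩).2 hxy]
      have h2 : ∀ j (hx : l x = j), (⟨j, Quotient.mk _ ⟨x, hx⟩⟩ :
          Σ i, Quotient (onFiber P l i)) = ⟨l x, Quotient.mk _ ⟨x, rfl⟩⟩ := by
        rintro j rfl; rfl
      exact (h2 _ hl).symm.trans (this _ hl rfl)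
    · rintro ⟨y⟩
      exact ⟨⟨l y, Quotient.mk _ ⟨y, rfl⟩⟩, rfl⟩
  simp only [classProd, finprod_eq_prod_of_fintype]
  rw [← Fintype.prod_sigma' fun i (q : Quotient (onFiber P l i)) =>
    a (Nat.card {x // Quotient.mk _ x = q})]
  symm
  refine Fintype.prod_bijective f hf _ _ ?_
  rintro ⟨i, ⟨x⟩⟩
  refine congrArg a (Nat.card_congr ?_)
  exact
    { toFun := fun y => ⟨y.1.1, (hmk i y.1 x).1 y.2⟩
      invFun := fun y => ⟨⟨y.1, (show l y.1 = l x.1 from h (Quotient.exact y.2)).trans x.2⟩,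
        (hmk i _ x).2 y.2⟩
      left_inv := fun _ => rfl
      right_inv := fun _ => rfl }

open Classical in
/-- The sum over the equivalence relations that refine the fibers of `l` and whose restrictions to
the fibers have prescribed properties factors over the fibers. -/
theorem sum_classProd_eq_prod_sum [Finite ι] [Fintype κ] (a : ℕ → K) (l : ι → κ)
    (A : ∀ i, Setoid {x // l x = i} → Prop) :
    ∑ P : Setoid ι with P ≤ Setoid.ker l ∧ ∀ i, A i (onFiber P l i), classProd a P =
      ∏ i, ∑ R : Setoid {x // l x = i} with A i R, classProd a R := by
  rw [Finset.prod_univ_sum]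
  refine Finset.sum_bij' (fun P _ i => onFiber P l i) (fun R _ => glue l R) ?_ ?_ ?_ ?_ ?_
  · intro P hP
    simpa using (Finset.mem_filter.1 hP).2.2
  · intro R hR
    simp only [Fintype.mem_piFinset, Finset.mem_filter, Finset.mem_univ, true_and] at hR ⊢
    exact ⟨glue_le l R, fun i => by rw [onFiber_glue]; exact hR i⟩
  · intro P hP
    exact glue_onFiber (Finset.mem_filter.1 hP).2.1
  · intro R hR
    exact funext fun i => onFiber_glue l R i
  · intro P hP
    exact classProd_eq_prod_onFiber a (Finset.mem_filter.1 hP).2.1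

open Classical in
theorem sum_classProd_congr [Finite ι] [Finite ι'] (a : ℕ → K) (e : ι ≃ ι') {A : Setoid ι → Prop}
    {B : Setoid ι' → Prop} (h : ∀ P, A (P.comap e) ↔ B P) :
    ∑ P : Setoid ι with A P, classProd a P = ∑ P : Setoid ι' with B P, classProd a P := by
  have h1 : ∀ P : Setoid ι, (P.comap e.symm).comap e = P := fun P => Setoid.ext fun x y => by
    simp [Setoid.comap_rel]
  have h2 : ∀ P : Setoid ι', (P.comap e).comap e.symm = P := fun P => Setoid.ext fun x y => by
    simp [Setoid.comap_rel]
  refine Finset.sum_bij' (fun P _ => P.comap e.symm) (fun P _ => P.comap e) ?_ ?_ ?_ ?_ ?_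
  · intro P hP
    simpa [← h, h1] using hP
  · intro P hP
    simpa [h] using hP
  · intro P _
    exact h1 P
  · intro P _
    exact h2 P
  · intro P _
    exact (classProd_comap_equiv a e.symm P).symm

end Setoids

/-! ## Noncrossing equivalence relations on linear orders -/

section Noncrossing

attribute [local instance] fintypeSetoid

variable {K : Type*} [Field K] {ι ι' κ : Type*} [LinearOrder ι] [LinearOrder ι']

/-- No two distinct classes cross. -/
def Noncrossing (P : Setoid ι) : Prop :=
  ∀ a b c d : ι, a < c → c < b → b < d → P a b → P c d → P a c

/-- The finest noncrossing equivalence relation that is coarser than `P`. -/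
def ncClosure (P : Setoid ι) : Setoid ι :=
  sInf {Q | Noncrossing Q ∧ P ≤ Q}

theorem noncrossing_top : Noncrossing (⊤ : Setoid ι) := fun _ _ _ _ _ _ _ _ _ => trivial

theorem noncrossing_ncClosure (P : Setoid ι) : Noncrossing (ncClosure P) :=
  fun a b c d h1 h2 h3 hab hcd Q hQ => hQ.1 a b c d h1 h2 h3 (hab Q hQ) (hcd Q hQ)

theorem le_ncClosure (P : Setoid ι) : P ≤ ncClosure P :=
  le_sInf fun _ hQ => hQ.2

theorem ncClosure_le {P Q : Setoid ι} (hQ : Noncrossing Q) (h : P ≤ Q) : ncClosure P ≤ Q :=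
  sInf_le ⟨hQ, h⟩

theorem Noncrossing.ncClosure_eq {P : Setoid ι} (hP : Noncrossing P) : ncClosure P = P :=
  le_antisymm (ncClosure_le hP le_rfl) (le_ncClosure P)

theorem Noncrossing.comap {f : ι → ι'} (hf : StrictMono f) {P : Setoid ι'} (hP : Noncrossing P) :
    Noncrossing (P.comap f) :=
  fun _ _ _ _ h1 h2 h3 => hP _ _ _ _ (hf h1) (hf h2) (hf h3)

/-- A class that meets the convex hull of another one and its complement equals it. -/
theorem Noncrossing.rel_of_mem_hull {P : Setoid ι} (hP : Noncrossing P) {a b c d : ι}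
    (hac : a ≤ c) (hcb : c ≤ b) (hd : d ≤ a ∨ b ≤ d) (hab : P a b) (hcd : P c d) : P a c := by
  rcases hac.eq_or_lt with rfl | hac
  · exact P.refl a
  rcases hcb.eq_or_lt with rfl | hcb
  · exact hab
  rcases hd with hd | hd
  · rcases hd.eq_or_lt with rfl | hd
    · exact P.symm hcd
    · exact P.trans (P.symm (hP _ _ _ _ hd hac hcb (P.symm hcd) hab)) (P.symm hcd)
  · rcases hd.eq_or_lt with rfl | hd
    · exact P.trans hab (P.symm hcd)
    · exact hP _ _ _ _ hac hcb hd hab hcd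

theorem noncrossing_comap_orderIso (e : ι ≃o ι') (P : Setoid ι') :
    Noncrossing (P.comap e) ↔ Noncrossing P := by
  refine ⟨fun h => ?_, fun h => h.comap e.strictMono⟩
  have := h.comap e.symm.strictMono
  rwa [show (P.comap e).comap e.symm = P from Setoid.ext fun x y => by
    simp [Setoid.comap_rel]] at this

theorem ncClosure_comap_orderIso_eq_top (e : ι ≃o ι') (P : Setoid ι') :
    ncClosure (P.comap e) = ⊤ ↔ ncClosure P = ⊤ := by
  constructor
  · intro h
    refine top_le_iff.1 fun x y _ => ?_
    have h1 : ncClosure (P.comap e) ≤ (ncClosure P).comap e :=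
      ncClosure_le ((noncrossing_ncClosure P).comap e.strictMono) fun _ _ hP => le_ncClosure P hP
    have h2 : ncClosure (P.comap e) (e.symm x) (e.symm y) := by rw [h]; trivial
    simpa [Setoid.comap_rel] using h1 h2
  · intro h
    refine top_le_iff.1 fun x y _ => ?_
    have h1 : ncClosure P ≤ (ncClosure (P.comap e)).comap e.symm :=
      ncClosure_le ((noncrossing_ncClosure _).comap e.symm.strictMono) fun x y hP =>
        le_ncClosure (P.comap e) (by simpa [Setoid.comap_rel] using hP)
    have h2 : ncClosure P (e x) (e y) := by rw [h]; trivial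
    simpa [Setoid.comap_rel] using h1 h2

/-- The closure can be computed class by class: closures taken inside the classes of a noncrossing
relation glue to a noncrossing relation, because crossing classes would have to lie in a common
class. -/
theorem ncClosure_eq_iff {P Q : Setoid ι} (hQ : Noncrossing Q) :
    ncClosure P = Q ↔ P ≤ Setoid.ker (Quotient.mk Q) ∧
      ∀ π : Quotient Q, ncClosure (onFiber P (Quotient.mk Q) π) = ⊤ := by
  have hker : Setoid.ker (Quotient.mk Q) = Q := Setoid.ker_mk_eq Q
  rw [hker]
  constructor
  · rintro rfl
    refine ⟨le_ncClosure P, fun π => ?_⟩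
    set l := Quotient.mk (ncClosure P) with hl
    -- The glued relation is noncrossing and coarser than `P`, so minimality puts `ncClosure P`
    -- below it; hence each local closure is everything.
    have hle : P ≤ glue l fun π => ncClosure (onFiber P l π) := fun x y hxy =>
      (glue_iff l _ rfl (Quotient.sound ((ncClosure P).symm (le_ncClosure P hxy)))).2
        (le_ncClosure (onFiber P l _) hxy)
    have hnc : Noncrossing (glue l fun π => ncClosure (onFiber P l π)) := by
      intro a b c d h1 h2 h3 hab hcd
      have hab' : l a = l b := glue_le _ _ hab
      have hcd' : l c = l d := glue_le _ _ hcd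
      have hac : l a = l c := Quotient.sound
        (hQ a b c d h1 h2 h3 (Quotient.exact hab') (Quotient.exact hcd'))
      rw [glue_iff l _ rfl hac.symm]
      rw [glue_iff l _ rfl hab'.symm] at hab
      rw [glue_iff l _ hac.symm (hac.trans hcd').symm] at hcd
      exact noncrossing_ncClosure _ _ _ _ _ (Subtype.mk_lt_mk.2 h1) (Subtype.mk_lt_mk.2 h2)
        (Subtype.mk_lt_mk.2 h3) hab hcd
    refine top_le_iff.1 fun x y _ => ?_
    have hxy : ncClosure P x.1 y.1 := Quotient.exact (x.2.trans y.2.symm)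
    exact (glue_iff l _ x.2 y.2).1 (ncClosure_le hnc hle hxy)
  · rintro ⟨hle, h⟩
    refine le_antisymm (ncClosure_le hQ hle) fun x y hxy => ?_
    have h1 : ncClosure (onFiber P (Quotient.mk Q) (Quotient.mk Q x)) ≤
        onFiber (ncClosure P) (Quotient.mk Q) (Quotient.mk Q x) :=
      ncClosure_le ((noncrossing_ncClosure P).comap (Subtype.strictMono_coe _))
        fun _ _ hP => le_ncClosure P hP
    rw [h] at h1
    exact h1 (show (⊤ : Setoid _) ⟨x, rfl⟩ ⟨y, Quotient.sound (Q.symm hxy)⟩ from trivial)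

/-! ### Weighted sums over equivalence relations -/

open Classical in
/-- The sum of `a_P` over all equivalence relations on `Fin n` whose noncrossing closure has a
single class. -/
def connectedSum (a : ℕ → K) (n : ℕ) : K :=
  ∑ P : Setoid (Fin n) with ncClosure P = ⊤, classProd a P

open Classical in
/-- The sum of `a_P` over all noncrossing equivalence relations on `Fin n`. -/
def noncrossingSum (a : ℕ → K) (n : ℕ) : K :=
  ∑ P : Setoid (Fin n) with Noncrossing P, classProd a P

/-- The sum of `a_P` over all equivalence relations on `Fin n`. -/
def setoidSum (a : ℕ → K) (n : ℕ) : K :=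
  ∑ P : Setoid (Fin n), classProd a P

theorem exists_orderIso_fin (ι : Type*) [LinearOrder ι] [Finite ι] :
    Nonempty (ι ≃o Fin (Nat.card ι)) := by
  have := Fintype.ofFinite ι
  exact ⟨(Fintype.orderIsoFinOfCardEq ι Nat.card_eq_fintype_card.symm).symm⟩

open Classical in
theorem sum_connected_eq [Finite ι] (a : ℕ → K) :
    ∑ P : Setoid ι with ncClosure P = ⊤, classProd a P = connectedSum a (Nat.card ι) := by
  obtain ⟨e⟩ := exists_orderIso_fin ι
  exact sum_classProd_congr a e.toEquiv (ncClosure_comap_orderIso_eq_top e)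

open Classical in
theorem sum_noncrossing_eq [Finite ι] (a : ℕ → K) :
    ∑ P : Setoid ι with Noncrossing P, classProd a P = noncrossingSum a (Nat.card ι) := by
  obtain ⟨e⟩ := exists_orderIso_fin ι
  exact sum_classProd_congr a e.toEquiv (noncrossing_comap_orderIso e)

theorem sum_setoid_eq {ι : Type*} [Finite ι] (a : ℕ → K) :
    ∑ P : Setoid ι, classProd a P = setoidSum a (Nat.card ι) := by
  classical
  have e := Finite.equivFin ι
  simpa [setoidSum] using sum_classProd_congr a e (A := fun _ => True) (B := fun _ => True)
    fun _ => Iff.rfl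

open Classical in
-- By `ncClosure_eq_iff` the condition splits into independent conditions on the classes of `Q`,
-- each contributing a `connectedSum`.
theorem sum_ncClosure_eq [Finite ι] (a : ℕ → K) {Q : Setoid ι} (hQ : Noncrossing Q) :
    ∑ P : Setoid ι with ncClosure P = Q, classProd a P = classProd (connectedSum a) Q := by
  have := Fintype.ofFinite ι
  simp only [ncClosure_eq_iff hQ]
  rw [sum_classProd_eq_prod_sum a (Quotient.mk Q) fun _ R => ncClosure R = ⊤, classProd,
    finprod_eq_prod_of_fintype]
  exact Finset.prod_congr rfl fun π _ => sum_connected_eq a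

/-- The sum over all partitions, grouped by noncrossing closures. -/
theorem setoidSum_eq_noncrossingSum (a : ℕ → K) (n : ℕ) :
    setoidSum a n = noncrossingSum (connectedSum a) n := by
  classical
  rw [setoidSum, noncrossingSum,
    ← Finset.sum_fiberwise_of_maps_to (s := Finset.univ) (g := ncClosure)
      (t := Finset.univ.filter Noncrossing)
      fun P _ => Finset.mem_filter.2 ⟨Finset.mem_univ _, noncrossing_ncClosure P⟩]
  exact Finset.sum_congr rfl fun Q hQ => sum_ncClosure_eq a (Finset.mem_filter.1 hQ).2

/-- All classes of a relation other than `⊤` are proper subsets, so only weights of smaller index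
occur. This drives the induction that recovers the weights. -/
theorem classProd_congr {ι : Type*} [Finite ι] {a b : ℕ → K} {P : Setoid ι}
    (h : ∀ n, 0 < n → n < Nat.card ι → a n = b n) (hP : P ≠ ⊤) :
    classProd a P = classProd b P := by
  classical
  have := Fintype.ofFinite ι
  refine finprod_congr fun π => h _ ?_ ?_
  · obtain ⟨x, rfl⟩ := Quotient.exists_rep π
    have : Nonempty {y // Quotient.mk P y = Quotient.mk P x} := ⟨⟨x, rfl⟩⟩
    exact Nat.card_pos
  · rw [Nat.card_eq_fintype_card, Nat.card_eq_fintype_card]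
    by_contra hlt
    obtain hall : ∀ x, Quotient.mk P x = π := by
      by_contra hx
      push Not at hx
      obtain ⟨x, hx⟩ := hx
      exact hlt (Fintype.card_subtype_lt (x := x) hx)
    exact hP (top_le_iff.1 fun x y _ => Quotient.exact ((hall x).trans (hall y).symm))

/-- The sums over noncrossing partitions determine the weights. -/
theorem eq_of_noncrossingSum_eq {a b : ℕ → K}
    (h : ∀ n, 0 < n → noncrossingSum a n = noncrossingSum b n) (n : ℕ) (hn : 0 < n) :
    a n = b n := by
  classical
  induction n using Nat.strong_induction_on with
  | _ n ih =>
    have : Nonempty (Fin n) := ⟨⟨0, hn⟩⟩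
    -- The one-block term isolates `f n`; the remaining terms involve only smaller indices.
    have key : ∀ f : ℕ → K, noncrossingSum f n = f n +
        ∑ P ∈ (Finset.univ.filter (Noncrossing (ι := Fin n))).erase ⊤, classProd f P := fun f => by
      rw [noncrossingSum, ← Finset.add_sum_erase _ _
        (Finset.mem_filter.2 ⟨Finset.mem_univ _, noncrossing_top⟩), classProd_top, Nat.card_fin]
    have h1 := h n hn
    rw [key a, key b, Finset.sum_congr rfl fun P hP => classProd_congr (b := b)
      (fun j hj hjn => ih j (by simpa using hjn) hj) (Finset.mem_erase.1 hP).1] at h1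
    exact add_right_cancel h1

end Noncrossing

/-! ## Gaps of a subset -/

section Gaps

attribute [local instance] fintypeSetoid

variable {K : Type*} [Field K] {n : ℕ}

/-- The label `0` for the elements of `X`, and `i + 1` for those of the `i`-th gap of `X`. -/
def gapLabel (X : Finset (Fin n)) (x : Fin n) : Fin (X.card + 2) :=
  if x ∈ X then 0 else
    Fin.succ ⟨(X.filter (· < x)).card, Nat.lt_succ_of_le (Finset.card_filter_le _ _)⟩

theorem gapLabel_eq_zero {X : Finset (Fin n)} {x : Fin n} : gapLabel X x = 0 ↔ x ∈ X := by
  unfold gapLabel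
  split_ifs with h
  · simp [h]
  · simp [h]

theorem gapLabel_eq_succ {X : Finset (Fin n)} {x : Fin n} {i : Fin (X.card + 1)} :
    gapLabel X x = i.succ ↔ x ∈ gap X i := by
  unfold gapLabel gap
  split_ifs with h
  · simp [h, (Fin.succ_ne_zero i).symm]
  · simp [h, Fin.ext_iff]

theorem card_gapLabel_zero (X : Finset (Fin n)) : Nat.card {x // gapLabel X x = 0} = X.card := by
  simp only [gapLabel_eq_zero]
  simp

theorem card_gapLabel_succ (X : Finset (Fin n)) (i : Fin (X.card + 1)) :
    Nat.card {x // gapLabel X x = i.succ} = (gap X i).card := by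
  simp only [gapLabel_eq_succ]
  simp

/-- The number of earlier points of `X` is monotone and increases exactly when a point of `X` is
passed. -/
theorem gapLabel_eq_iff {X : Finset (Fin n)} {x y : Fin n} (hx : x ∉ X) (hxy : x ≤ y) :
    gapLabel X x = gapLabel X y ↔ ∀ z, x ≤ z → z ≤ y → z ∉ X := by
  constructor
  · intro h z hxz hzy hz
    have hy : y ∉ X := fun hy => hx (gapLabel_eq_zero.1 (h.trans (gapLabel_eq_zero.2 hy)))
    have hcard : (X.filter (· < x)).card = (X.filter (· < y)).card := by
      simpa [gapLabel, hx, hy] using h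
    have hlt : (X.filter (· < x)).card < (X.filter (· < y)).card := by
      refine Finset.card_lt_card (Finset.ssubset_iff_of_subset ?_ |>.2 ⟨z, ?_, ?_⟩)
      · exact fun w hw => by
          simp only [Finset.mem_filter] at hw ⊢
          exact ⟨hw.1, hw.2.trans_le hxy⟩
      · exact Finset.mem_filter.2 ⟨hz, lt_of_le_of_ne hzy fun h => hy (h ▸ hz)⟩
      · simp [hxz]
    exact hlt.ne hcard
  · intro h
    have hy : y ∉ X := h y hxy le_rfl
    have : X.filter (· < x) = X.filter (· < y) := by
      refine Finset.filter_congr fun w hw => ⟨fun hwx => hwx.trans_le hxy, fun hwy => ?_⟩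
      by_contra hwx
      exact h w (not_lt.1 hwx) hwy.le hw
    simp [gapLabel, hx, hy, this]

theorem noncrossing_ker_gapLabel (X : Finset (Fin n)) : Noncrossing (Setoid.ker (gapLabel X)) := by
  intro a b c d hac hcb hbd hab hcd
  simp only [Setoid.ker_def] at hab hcd ⊢
  by_cases ha : a ∈ X
  · have hb : b ∈ X := gapLabel_eq_zero.1 (hab.symm.trans (gapLabel_eq_zero.2 ha))
    by_cases hc : c ∈ X
    · rw [gapLabel_eq_zero.2 ha, gapLabel_eq_zero.2 hc]
    · exact ((gapLabel_eq_iff hc (hcb.trans hbd).le).1 hcd b hcb.le hbd.le hb).elim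
  · rw [gapLabel_eq_iff ha (hac.trans hcb).le] at hab
    rw [gapLabel_eq_iff ha hac.le]
    exact fun z h1 h2 => hab z h1 (h2.trans hcb.le)

/-- The class of the first element separates the other classes of a noncrossing relation. -/
theorem Noncrossing.le_ker_gapLabel {P : Setoid (Fin n)} (hP : Noncrossing P) {o : Fin n}
    (ho : ∀ x, o ≤ x) {X : Finset (Fin n)} (hX : ∀ x, x ∈ X ↔ P o x) :
    P ≤ Setoid.ker (gapLabel X) := by
  have key : ∀ x y, x ≤ y → P x y → gapLabel X x = gapLabel X y := by
    intro x y hle hxy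
    by_cases hx : x ∈ X
    · rw [gapLabel_eq_zero.2 hx, gapLabel_eq_zero.2 ((hX y).2 (P.trans ((hX x).1 hx) hxy))]
    · rw [gapLabel_eq_iff hx hle]
      intro z hxz hzy hz
      have := hP.rel_of_mem_hull hxz hzy (Or.inl (ho x)) hxy (P.symm ((hX z).1 hz))
      exact hx ((hX x).2 (P.trans ((hX z).1 hz) (P.symm this)))
  intro x y hxy
  rcases le_total x y with h | h
  · exact key x y h hxy
  · exact (key y x h (P.symm hxy)).symm

/-- The gap labelling is itself noncrossing, so a crossing of two classes of `P` could only happen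
inside one fiber. This makes the choices on the gaps independent. -/
theorem noncrossing_and_class_iff {P : Setoid (Fin n)} {o : Fin n} (ho : ∀ x, o ≤ x)
    {X : Finset (Fin n)} (hoX : o ∈ X) :
    (Noncrossing P ∧ ∀ x, x ∈ X ↔ P o x) ↔ P ≤ Setoid.ker (gapLabel X) ∧
      ∀ i : Fin (X.card + 2), (i = 0 → onFiber P (gapLabel X) i = ⊤) ∧
        (i ≠ 0 → Noncrossing (onFiber P (gapLabel X) i)) := by
  constructor
  · rintro ⟨hP, hX⟩
    refine ⟨hP.le_ker_gapLabel ho hX, fun i => ⟨?_, fun _ =>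
      hP.comap (Subtype.strictMono_coe _)⟩⟩
    rintro rfl
    refine top_le_iff.1 fun x y _ => ?_
    exact P.trans (P.symm ((hX _).1 (gapLabel_eq_zero.1 x.2))) ((hX _).1 (gapLabel_eq_zero.1 y.2))
  · rintro ⟨hle, h⟩
    have hX : ∀ x, x ∈ X → ∀ y, y ∈ X → P x y := fun x hx y hy => by
      have h0 := (h 0).1 rfl
      have : onFiber P (gapLabel X) 0 ⟨x, gapLabel_eq_zero.2 hx⟩ ⟨y, gapLabel_eq_zero.2 hy⟩ := by
        rw [h0]; trivial
      exact this
    refine ⟨?_, fun x => ⟨fun hx => hX o hoX x hx, fun hox => gapLabel_eq_zero.1 ?_⟩⟩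
    · intro a b c d hac hcb hbd hab hcd
      have hlac := noncrossing_ker_gapLabel X a b c d hac hcb hbd (hle hab) (hle hcd)
      simp only [Setoid.ker_def] at hlac
      by_cases ha : gapLabel X a = 0
      · exact hX a (gapLabel_eq_zero.1 ha) c (gapLabel_eq_zero.1 (hlac ▸ ha))
      · exact (h (gapLabel X a)).2 ha ⟨a, rfl⟩ ⟨b, (hle hab).symm⟩ ⟨c, hlac.symm⟩
          ⟨d, (hle hcd).symm.trans hlac.symm⟩ hac hcb hbd hab hcd
    · exact (hle hox).symm.trans (gapLabel_eq_zero.2 hoX)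

theorem noncrossingSum_zero (a : ℕ → K) : noncrossingSum a 0 = 1 := by
  classical
  have h : ∀ P : Setoid (Fin 0), P = ⊤ := fun P => Setoid.ext fun x => isEmptyElim x
  have h1 : (Finset.univ.filter (Noncrossing (ι := Fin 0))) = {⊤} := by
    ext P
    rw [h P]
    simp [noncrossing_top]
  rw [noncrossingSum, h1, Finset.sum_singleton, classProd_of_isEmpty]

open Classical in
/-- The sum over the noncrossing partitions of a nonempty linear order, grouped by the first
block. -/
theorem noncrossingSum_eq_sum_first (a : ℕ → K) (n : ℕ) :
    noncrossingSum a (n + 1) = ∑ X : Finset (Fin (n + 1)) with 0 ∈ X,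
      a X.card * ∏ i ∈ Finset.range (X.card + 1), noncrossingSum a (gap X i).card := by
  rw [noncrossingSum, ← Finset.sum_fiberwise_of_maps_to
    (g := fun P : Setoid (Fin (n + 1)) => Finset.univ.filter (P 0))
    (t := Finset.univ.filter (fun X => (0 : Fin (n + 1)) ∈ X))
    fun P _ => by simp]
  refine Finset.sum_congr rfl fun X hX => ?_
  have hX0 : 0 ∈ X := (Finset.mem_filter.1 hX).2
  have hne : Nonempty {x // gapLabel X x = 0} := ⟨⟨0, gapLabel_eq_zero.2 hX0⟩⟩
  rw [Finset.filter_filter]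
  have h1 : ∀ P : Setoid (Fin (n + 1)), (Noncrossing P ∧ Finset.univ.filter (P 0) = X) ↔
      (Noncrossing P ∧ ∀ x, x ∈ X ↔ P 0 x) := fun P => by
    simp [Finset.ext_iff, iff_comm]
  simp only [h1, noncrossing_and_class_iff (fun x => Fin.zero_le x) hX0]
  refine (Eq.trans ?_ (sum_classProd_eq_prod_sum a (gapLabel X) fun i R => (i = 0 → R = ⊤) ∧
    (i ≠ 0 → Noncrossing R))).trans ?_
  · congr!
  rw [Fin.prod_univ_succ, ← Fin.prod_univ_eq_prod_range
      (fun i => noncrossingSum a (gap X i).card)]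
  congr 1
  · simp only [ne_eq, not_true_eq_false, false_imp_iff, and_true, forall_const]
    rw [Finset.sum_eq_single_of_mem ⊤ (by simp) fun P hP h => (h (by simpa using hP)).elim,
      classProd_top, card_gapLabel_zero]
  · refine Finset.prod_congr rfl fun i _ => ?_
    rw [← card_gapLabel_succ, ← sum_noncrossing_eq]
    simp [Fin.succ_ne_zero]

/-! ## Sums over subsets, grouped by their gaps -/

/-- Splitting by whether `0` belongs to the subset is the basis of all recursions below. -/
theorem sum_finset_fin_succ {M : Type*} [AddCommMonoid M] (f : Finset (Fin (n + 1)) → M) :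
    ∑ X, f X = ∑ Y : Finset (Fin n), f (Y.map (Fin.succEmb n)) +
      ∑ Y : Finset (Fin n), f (insert 0 (Y.map (Fin.succEmb n))) := by
  classical
  have h0 : (0 : Fin (n + 1)) ∉ Finset.univ.map (Fin.succEmb n) := by simp [Fin.succ_ne_zero]
  have h1 : (Finset.univ : Finset (Finset (Fin (n + 1)))) =
      (insert 0 (Finset.univ.map (Fin.succEmb n))).powerset := by
    rw [← Finset.powerset_univ, ← Finset.cons_eq_insert _ _ h0]
    congr 1
    ext x
    refine Fin.cases ?_ ?_ x <;> simp
  have h2 : ∀ g : Finset (Fin (n + 1)) → M,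
      ∑ X ∈ (Finset.univ.map (Fin.succEmb n)).powerset, g X =
        ∑ Y : Finset (Fin n), g (Y.map (Fin.succEmb n)) := fun g => by
    symm
    refine Finset.sum_bij (fun Y _ => Y.map (Fin.succEmb n)) ?_ ?_ ?_ ?_
    · intro Y _
      exact Finset.mem_powerset.2 (Finset.map_subset_map.2 (Finset.subset_univ Y))
    · intro Y _ Z _ h
      exact Finset.map_injective _ h
    · intro X hX
      obtain ⟨Y, -, rfl⟩ := Finset.subset_map_iff.1 (Finset.mem_powerset.1 hX)
      exact ⟨Y, Finset.mem_univ _, rfl⟩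
    · intro _ _
      rfl
  rw [h1, Finset.sum_powerset_insert h0, h2, h2 fun X => f (insert 0 X)]

theorem card_filter_lt_succ_map (Y : Finset (Fin n)) (y : Fin n) :
    ((Y.map (Fin.succEmb n)).filter (· < y.succ)).card = (Y.filter (· < y)).card := by
  rw [Finset.filter_map, Finset.card_map]
  exact congrArg Finset.card (Finset.filter_congr fun z _ => Fin.succ_lt_succ_iff)

theorem card_filter_lt_succ_insert (Y : Finset (Fin n)) (y : Fin n) :
    ((insert 0 (Y.map (Fin.succEmb n))).filter (· < y.succ)).card =
      (Y.filter (· < y)).card + 1 := by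
  rw [Finset.filter_insert, if_pos (Fin.succ_pos y), Finset.card_insert_of_notMem (by simp),
    card_filter_lt_succ_map]

theorem gap_map_succ_zero (Y : Finset (Fin n)) :
    (gap (Y.map (Fin.succEmb n)) 0).card = (gap Y 0).card + 1 := by
  have : gap (Y.map (Fin.succEmb n)) 0 = insert 0 ((gap Y 0).map (Fin.succEmb n)) := by
    ext x
    refine Fin.cases ?_ (fun y => ?_) x
    · simp [gap, Fin.succ_ne_zero]
    · simp only [gap, Finset.mem_filter, card_filter_lt_succ_map]
      simp [Fin.succ_ne_zero]
  rw [this, Finset.card_insert_of_notMem (by simp), Finset.card_map]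

theorem gap_map_succ_succ (Y : Finset (Fin n)) (i : ℕ) :
    (gap (Y.map (Fin.succEmb n)) (i + 1)).card = (gap Y (i + 1)).card := by
  have : gap (Y.map (Fin.succEmb n)) (i + 1) = (gap Y (i + 1)).map (Fin.succEmb n) := by
    ext x
    refine Fin.cases ?_ (fun y => ?_) x
    · simp [gap]
    · simp only [gap, Finset.mem_filter, card_filter_lt_succ_map]
      simp
  rw [this, Finset.card_map]

theorem gap_insert_zero (Y : Finset (Fin n)) :
    (gap (insert 0 (Y.map (Fin.succEmb n))) 0).card = 0 := by
  rw [Finset.card_eq_zero, Finset.eq_empty_iff_forall_notMem]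
  intro x
  refine Fin.cases ?_ (fun y => ?_) x
  · simp [gap]
  · simp only [gap, Finset.mem_filter, card_filter_lt_succ_insert]
    simp

theorem gap_insert_succ (Y : Finset (Fin n)) (i : ℕ) :
    (gap (insert 0 (Y.map (Fin.succEmb n))) (i + 1)).card = (gap Y i).card := by
  have : gap (insert 0 (Y.map (Fin.succEmb n))) (i + 1) = (gap Y i).map (Fin.succEmb n) := by
    ext x
    refine Fin.cases ?_ (fun y => ?_) x
    · simp [gap]
    · simp only [gap, Finset.mem_filter, card_filter_lt_succ_insert]
      simp [Fin.succ_ne_zero]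
  rw [this, Finset.card_map]

/-! ### Gap sums and power series -/

/-- The sum over all subsets, weighted by their cardinality and by those of their gaps, where the
initial gap has a weight of its own. -/
def gapSum (a u v : ℕ → K) (n : ℕ) : K :=
  ∑ X : Finset (Fin n), a X.card *
    (u (gap X 0).card * ∏ i ∈ Finset.range X.card, v (gap X (i + 1)).card)

/-- The point `0` either enlarges the initial gap, which shifts `u`, or joins the subset; then the
initial gap is empty and the next gap carries the weight `v`. -/
theorem gapSum_succ (a u v : ℕ → K) (n : ℕ) :
    gapSum a u v (n + 1) = gapSum a (fun j => u (j + 1)) v n +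
      u 0 * gapSum (fun j => a (j + 1)) v v n := by
  rw [gapSum, sum_finset_fin_succ, gapSum, gapSum, Finset.mul_sum]
  congr 1
  · simp only [Finset.card_map, gap_map_succ_zero, gap_map_succ_succ]
  · refine Finset.sum_congr rfl fun Y _ => ?_
    rw [Finset.card_insert_of_notMem (by simp), Finset.card_map, gap_insert_zero]
    simp only [gap_insert_succ]
    rw [Finset.prod_range_succ']
    ring

theorem gapSum_congr {a u v : ℕ → K} (h : ∀ j ≤ n, u j = v j) :
    gapSum a u u n = gapSum a v v n := by
  have hle : ∀ (X : Finset (Fin n)) i, (gap X i).card ≤ n := fun X i => by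
    simpa using Finset.card_le_univ (gap X i)
  simp only [gapSum, h _ (hle _ _)]

/-- Removing `0` from the first block leaves an arbitrary subset of the other points; the gap before
`0` is empty and contributes `1`. -/
theorem noncrossingSum_succ (a : ℕ → K) (n : ℕ) :
    noncrossingSum a (n + 1) =
      gapSum (fun j => a (j + 1)) (noncrossingSum a) (noncrossingSum a) n := by
  classical
  rw [noncrossingSum_eq_sum_first, Finset.sum_filter, sum_finset_fin_succ, Finset.sum_eq_zero,
    zero_add, gapSum]
  · refine Finset.sum_congr rfl fun Y _ => ?_
    rw [if_pos (by simp), Finset.card_insert_of_notMem (by simp), Finset.card_map,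
      Finset.prod_range_succ', gap_insert_zero, noncrossingSum_zero, mul_one]
    simp only [gap_insert_succ]
    rw [Finset.prod_range_succ', mul_comm (noncrossingSum a (gap Y 0).card)]
  · intro Y _
    simp [Fin.succ_ne_zero]

open PowerSeries in
-- A subset of size `s` is encoded by the sizes of its `s + 1` gaps, whence `z ^ s` times one factor
-- `u` and `s` factors `v`. The induction varies `a` and `u`, since peeling off a point shifts them.
theorem gapSum_eq_sum_coeff (a u v : ℕ → K) (n : ℕ) :
    gapSum a u v n = ∑ s ∈ Finset.range (n + 1),
      a s * coeff n (X ^ s * (mk u * mk v ^ s) : PowerSeries K) := by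
  induction n generalizing a u with
  | zero =>
    rw [gapSum, Fintype.sum_unique, Subsingleton.elim default (∅ : Finset (Fin 0))]
    simp [gap]
  | succ n ih =>
    have hu : mk u = C (u 0) + X * mk (fun j => u (j + 1)) := by
      ext j
      cases j with
      | zero => simp
      | succ j => simp [coeff_succ_X_mul]
    have h1 : ∀ s, coeff (n + 1) (X ^ s * (mk u * mk v ^ s)) =
        u 0 * coeff (n + 1) (X ^ s * mk v ^ s) +
          coeff n (X ^ s * (mk (fun j => u (j + 1)) * mk v ^ s)) := fun s => by
      rw [hu, ← coeff_C_mul, ← coeff_succ_X_mul n, ← map_add]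
      exact congrArg _ (by ring)
    have h2 : ∀ s, coeff (n + 1) (X ^ (s + 1) * mk v ^ (s + 1)) =
        coeff n (X ^ s * (mk v * mk v ^ s)) := fun s => by
      rw [← coeff_succ_X_mul n]
      exact congrArg _ (by ring)
    rw [gapSum_succ, ih, ih]
    simp only [h1, mul_add, Finset.sum_add_distrib]
    rw [add_comm]
    congr 1
    -- Here the term `s = 0` vanishes, being a positive-degree coefficient of `1`.
    · rw [Finset.sum_range_succ' _ (n + 1)]
      simp only [h2, Finset.mul_sum]
      simp [coeff_one, mul_left_comm]
    -- Here the top term `s = n + 1` vanishes, since `X ^ (n + 1)` has no coefficient in degree `n`.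
    · rw [Finset.sum_range_succ _ (n + 1), coeff_X_pow_mul', if_neg (by omega)]
      simp

end Gaps

/-! ## Moment-cumulant formulas -/

section Cumulants

attribute [local instance] fintypeSetoid

variable {K : Type*} [Field K]

theorem setoidSum_zero (a : ℕ → K) : setoidSum a 0 = 1 := by
  classical
  have h : ∀ P : Setoid (Fin 0), P = ⊤ := fun P => Setoid.ext fun x => isEmptyElim x
  have h1 : (Finset.univ : Finset (Setoid (Fin 0))) = {⊤} := by
    ext P
    rw [h P]
    simp
  rw [setoidSum, h1, Finset.sum_singleton, classProd_of_isEmpty]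

open Classical in
/-- The sum over the partitions of a nonempty set, grouped by the block of an element. -/
theorem setoidSum_eq_sum_first (a : ℕ → K) (n : ℕ) :
    setoidSum a (n + 1) = ∑ X : Finset (Fin (n + 1)) with 0 ∈ X,
      a X.card * setoidSum a (n + 1 - X.card) := by
  rw [setoidSum, ← Finset.sum_fiberwise_of_maps_to
    (g := fun P : Setoid (Fin (n + 1)) => Finset.univ.filter (P 0))
    (t := Finset.univ.filter (fun X => (0 : Fin (n + 1)) ∈ X))
    fun P _ => by simp]
  refine Finset.sum_congr rfl fun X hX => ?_
  have hX0 : 0 ∈ X := (Finset.mem_filter.1 hX).2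
  let l : Fin (n + 1) → Bool := fun x => decide (x ∈ X)
  have hl : ∀ x, l x = true ↔ x ∈ X := fun x => decide_eq_true_iff
  have hl' : ∀ x, l x = false ↔ x ∉ X := fun x => decide_eq_false_iff_not
  have h1 : ∀ P : Setoid (Fin (n + 1)), Finset.univ.filter (P 0) = X ↔
      P ≤ Setoid.ker l ∧ ∀ i, i = true → onFiber P l i = ⊤ := by
    intro P
    rw [Finset.ext_iff]
    simp only [Finset.mem_filter, Finset.mem_univ, true_and]
    constructor
    · intro h
      refine ⟨fun x y hxy => ?_, ?_⟩
      · rw [Setoid.ker_def, Bool.eq_iff_iff, hl, hl, ← h, ← h]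
        exact ⟨fun hx => P.trans hx hxy, fun hy => P.trans hy (P.symm hxy)⟩
      · rintro _ rfl
        exact top_le_iff.1 fun x y _ =>
          P.trans (P.symm ((h _).2 ((hl _).1 x.2))) ((h _).2 ((hl _).1 y.2))
    · rintro ⟨hle, h⟩ x
      refine ⟨fun hx => (hl x).1 ((hle hx).symm.trans ((hl 0).2 hX0)), fun hx => ?_⟩
      have : onFiber P l true ⟨0, (hl 0).2 hX0⟩ ⟨x, (hl x).2 hx⟩ := by
        rw [h true rfl]; trivial
      exact this
  have hne : Nonempty {x // l x = true} := ⟨⟨0, (hl 0).2 hX0⟩⟩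
  simp only [h1]
  refine (Eq.trans ?_ (sum_classProd_eq_prod_sum a l fun i R => i = true → R = ⊤)).trans ?_
  · congr!
  rw [Fintype.prod_bool]
  congr 1
  · simp only [forall_const]
    rw [Finset.sum_eq_single_of_mem ⊤ (by simp) fun P hP h => (h (by simpa using hP)).elim,
      classProd_top]
    simp only [hl]
    simp
  · simp only [reduceCtorEq, false_imp_iff, Finset.filter_true, sum_setoid_eq, hl']
    rw [Nat.card_eq_fintype_card, Fintype.card_subtype_compl]
    simp

theorem setoidSum_succ (a : ℕ → K) (n : ℕ) :
    setoidSum a (n + 1) = ∑ j ∈ Finset.range (n + 1),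
      (n.choose j : K) * (a (j + 1) * setoidSum a (n - j)) := by
  classical
  rw [setoidSum_eq_sum_first, Finset.sum_filter, sum_finset_fin_succ, Finset.sum_eq_zero,
    zero_add]
  · have h := Finset.sum_powerset_apply_card (fun j => a (j + 1) * setoidSum a (n - j))
      (x := (Finset.univ : Finset (Fin n)))
    rw [Finset.powerset_univ, Finset.card_fin] at h
    simp only [nsmul_eq_mul] at h
    rw [← h]
    refine Finset.sum_congr rfl fun Y _ => ?_
    rw [if_pos (by simp), Finset.card_insert_of_notMem (by simp), Finset.card_map,
      Nat.add_sub_add_right]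
  · intro Y _
    simp [Fin.succ_ne_zero]

/-! ### From generating series to recursions for the moments -/

open PowerSeries in
theorem derivative_logOf [CharZero K] {f : PowerSeries K} (hf : constantCoeff f = 1) :
    f * d⁄dX K (logOf f) = d⁄dX K f := by
  have hs : HasSubst (f - 1) := HasSubst.of_constantCoeff_zero' (by simp [hf])
  -- Substituting `f - 1` for `X` in this identity and applying the chain rule gives the claim.
  have h1 : ((1 : PowerSeries K) + X) * d⁄dX K (log K) = 1 := by
    rw [deriv_log]
    ext n
    cases n with
    | zero => simp
    | succ n => simp [add_mul, coeff_succ_X_mul, coeff_one, pow_succ]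
  have h2 := congrArg (substAlgHom (R := K) hs) h1
  rw [map_mul, map_add, map_one, substAlgHom_X, coe_substAlgHom, add_sub_cancel] at h2
  have h3 : d⁄dX K (f - 1) = d⁄dX K f := by simp
  rw [logOf_eq, derivative_subst hs, h3, ← mul_assoc, h2, one_mul]

/-- Compare coefficients of `z ^ n` in `E * (log E)' = E'`; the factorials combine to binomial
coefficients, giving the recursion of `setoidSum_succ`. -/
theorem moment_succ_eq_sum_classicalCumulant [CharZero K] {m : ℕ → K} (hm : m 0 = 1) (n : ℕ) :
    m (n + 1) = ∑ j ∈ Finset.range (n + 1),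
      (n.choose j : K) * (classicalCumulant m (j + 1) * m (n - j)) := by
  have hE : expMomentSeries m = PowerSeries.mk fun n => m n / (n.factorial : K) := by
    ext n
    cases n <;> simp [expMomentSeries, hm]
  have h := congrArg (PowerSeries.coeff n) (derivative_logOf (f := expMomentSeries m)
    (by simp [expMomentSeries]))
  rw [mul_comm, PowerSeries.coeff_mul, PowerSeries.coeff_derivative,
    Finset.Nat.sum_antidiagonal_eq_sum_range_succ_mk] at h
  simp only [PowerSeries.coeff_derivative] at h
  have hfac : ∀ j : ℕ, (j.factorial : K) ≠ 0 := fun j => Nat.cast_ne_zero.2 j.factorial_ne_zero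
  have hn : ((n : K) + 1) ≠ 0 := Nat.cast_add_one_ne_zero n
  rw [hE, PowerSeries.coeff_mk, Nat.factorial_succ] at h
  have h' : m (n + 1) = (n.factorial : K) *
      (m (n + 1) / ((n + 1) * n.factorial : ℕ) * ((n : K) + 1)) := by
    have := hfac n
    push_cast
    field_simp
  rw [h', ← h, Finset.mul_sum]
  refine Finset.sum_congr rfl fun j hj => ?_
  have hjn : j ≤ n := Nat.lt_succ_iff.1 (Finset.mem_range.1 hj)
  rw [← hE, classicalCumulant, Nat.cast_choose K hjn, Nat.factorial_succ]
  have := hfac j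
  have := hfac (n - j)
  rw [hE, PowerSeries.coeff_mk]
  push_cast
  field_simp

theorem moment_eq_setoidSum [CharZero K] {m : ℕ → K} (hm : m 0 = 1) (n : ℕ) :
    m n = setoidSum (classicalCumulant m) n := by
  induction n using Nat.strong_induction_on with
  | _ n ih =>
    cases n with
    | zero => rw [hm, setoidSum_zero]
    | succ n =>
      rw [moment_succ_eq_sum_classicalCumulant hm, setoidSum_succ]
      exact Finset.sum_congr rfl fun j _ => by rw [ih (n - j) (by omega)]

open PowerSeries in
theorem moment_succ_eq_gapSum {m k : ℕ → K} (hm : m 0 = 1) (hk : IsFreeCumulants m k) (n : ℕ) :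
    m (n + 1) = gapSum (fun j => k (j + 1)) m m n := by
  have hM : momentSeries m = mk m := by
    ext n
    cases n <;> simp [momentSeries, hm]
  have h := congrArg (coeff (n + 1)) hk
  rw [map_add, coeff_subst' (HasSubst.of_constantCoeff_zero' (by simp)), hM, coeff_mk,
    finsum_eq_sum_of_support_subset (s := Finset.range (n + 2))] at h
  -- The term `s = 0` drops out because `K` has no constant term; this shifts the index of `k` by
  -- one.
  · rw [h, Finset.sum_range_succ', gapSum_eq_sum_coeff]
    simp only [coeff_mk, smul_eq_mul, if_true, zero_mul, add_zero, Nat.add_eq_zero_iff,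
      one_ne_zero, and_false, if_false, coeff_one, zero_add]
    refine Finset.sum_congr rfl fun s _ => ?_
    rw [← coeff_succ_X_mul n]
    exact congrArg _ (congrArg _ (by ring))
  · intro s hs
    by_contra hlt
    refine hs ?_
    have : n + 2 ≤ s := by simpa using hlt
    simp only [mul_pow, coeff_X_pow_mul']
    rw [if_neg (by omega), smul_zero]

theorem moment_eq_noncrossingSum {m k : ℕ → K} (hm : m 0 = 1) (hk : IsFreeCumulants m k) (n : ℕ) :
    m n = noncrossingSum k n := by
  induction n using Nat.strong_induction_on with
  | _ n ih =>
    cases n with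
    | zero => rw [hm, noncrossingSum_zero]
    | succ n =>
      rw [moment_succ_eq_gapSum hm hk, noncrossingSum_succ]
      exact gapSum_congr fun j hj => ih j (Nat.lt_succ_of_le hj)

/-- The moment-cumulant formula for classical cumulants. -/
theorem moment_eq_sum_classicalCumulant [CharZero K] (m : ℕ → K) {n : ℕ} (hn : 0 < n) :
    m n = setoidSum (classicalCumulant m) n := by
  -- The value `m 0` is arbitrary and does not enter the series, so it may be replaced by `1`.
  have h := moment_eq_setoidSum (m := fun n => if n = 0 then 1 else m n) rfl n
  have hc : classicalCumulant (fun n => if n = 0 then 1 else m n) = classicalCumulant m := by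
    funext n
    rw [classicalCumulant, classicalCumulant]
    congr 3
    ext j
    by_cases hj : j = 0 <;> simp [expMomentSeries, hj]
  rwa [hc, if_neg hn.ne'] at h

/-- The moment-cumulant formula for free cumulants. -/
theorem moment_eq_sum_freeCumulant {m k : ℕ → K} (hk : IsFreeCumulants m k) {n : ℕ}
    (hn : 0 < n) : m n = noncrossingSum k n := by
  have hM : momentSeries (fun n => if n = 0 then 1 else m n) = momentSeries m := by
    ext j
    by_cases hj : j = 0 <;> simp [momentSeries, hj]
  have h := moment_eq_noncrossingSum (m := fun n => if n = 0 then 1 else m n) (k := k) rfl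
    (by rw [IsFreeCumulants, hM]; exact hk) n
  rwa [if_neg hn.ne'] at h

/-- The free cumulants are sums of products of classical cumulants over the partitions whose
noncrossing closure has a single block. -/
theorem freeCumulant_eq_connectedSum [CharZero K] {m k : ℕ → K} (hk : IsFreeCumulants m k) {n : ℕ}
    (hn : 0 < n) : k n = connectedSum (classicalCumulant m) n :=
  eq_of_noncrossingSum_eq (fun n hn => by
    rw [← moment_eq_sum_freeCumulant hk hn, moment_eq_sum_classicalCumulant m hn,
      setoidSum_eq_noncrossingSum]) n hn

end Cumulants

/-! ## Lowersets and noncrossing closures -/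

section Lowersets

variable {K : Type*} [Field K] {n : ℕ}

/-- A point of `X` between two equivalent points lies in the convex hull of their block, which pulls
that block into `X`. So every block lies in `X` or in a single gap. -/
theorem IsLowerset.le_ker_gapLabel {P : Setoid (Fin n)} {X : Finset (Fin n)}
    (hX : IsLowerset P X) : P ≤ Setoid.ker (gapLabel X) := by
  have key : ∀ x y, x ≤ y → P x y → gapLabel X x = gapLabel X y := by
    intro x y hle hxy
    by_cases hx : x ∈ X
    · have hy : y ∈ X := hX y x ⟨x, x, x, hxy, hxy, P.refl x, le_rfl, le_rfl⟩ hx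
      rw [gapLabel_eq_zero.2 hx, gapLabel_eq_zero.2 hy]
    · rw [gapLabel_eq_iff hx hle]
      exact fun z hxz hzy hz => hx
        (hX x z ⟨x, y, z, P.refl x, P.symm hxy, P.refl z, hxz, hzy⟩ hz)
  intro x y hxy
  rcases le_total x y with h | h
  · exact key x y h hxy
  · exact (key y x h (P.symm hxy)).symm

theorem isLowerset_empty (P : Setoid (Fin n)) : IsLowerset P ∅ := fun _ _ _ h => by simp at h

theorem exists_restrict_eq_comap_onFiber {κ : Type*} (P : Setoid (Fin n)) {X : Finset (Fin n)}
    {l : Fin n → κ} {i : κ} (h : ∀ x, l x = i ↔ x ∈ X) :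
    ∃ e : Fin X.card ≃o {x // l x = i}, restrict P X = (onFiber P l i).comap e :=
  ⟨(X.orderIsoOfFin rfl).trans
    ⟨Equiv.subtypeEquivRight fun x => (h x).symm, Iff.rfl⟩, rfl⟩

theorem classProd_restrict_eq {κ : Type*} (a : ℕ → K) (P : Setoid (Fin n)) {X : Finset (Fin n)}
    {l : Fin n → κ} {i : κ} (h : ∀ x, l x = i ↔ x ∈ X) :
    classProd a (restrict P X) = classProd a (onFiber P l i) := by
  obtain ⟨e, he⟩ := exists_restrict_eq_comap_onFiber P h
  rw [he]
  exact classProd_comap_equiv a e.toEquiv _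

theorem ncClosure_restrict_eq_top {κ : Type*} (P : Setoid (Fin n)) {X : Finset (Fin n)}
    {l : Fin n → κ} {i : κ} (h : ∀ x, l x = i ↔ x ∈ X) :
    ncClosure (restrict P X) = ⊤ ↔ ncClosure (onFiber P l i) = ⊤ := by
  obtain ⟨e, he⟩ := exists_restrict_eq_comap_onFiber P h
  rw [he]
  exact ncClosure_comap_orderIso_eq_top e _

theorem classProd_eq_restrict_mul_prod_gap (a : ℕ → K) {P : Setoid (Fin n)} {X : Finset (Fin n)}
    (hX : IsLowerset P X) : classProd a P = classProd a (restrict P X) *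
      ∏ i ∈ Finset.range (X.card + 1), classProd a (restrict P (gap X i)) := by
  rw [classProd_eq_prod_onFiber a hX.le_ker_gapLabel, Fin.prod_univ_succ,
    ← Fin.prod_univ_eq_prod_range (fun i => classProd a (restrict P (gap X i))),
    classProd_restrict_eq a P fun x => gapLabel_eq_zero]
  congr 1
  exact Finset.prod_congr rfl fun i _ =>
    (classProd_restrict_eq a P fun x => gapLabel_eq_succ).symm

/-- The only lowerset containing the first element whose restriction has a one-block noncrossing
closure is the first block of the noncrossing closure. -/
theorem isLowerset_connected_iff {P : Setoid (Fin n)} {o : Fin n} (ho : ∀ x, o ≤ x)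
    {X : Finset (Fin n)} :
    (IsLowerset P X ∧ o ∈ X ∧ nc (restrict P X) = ⊤) ↔ ∀ x, x ∈ X ↔ ncClosure P o x := by
  change (IsLowerset P X ∧ o ∈ X ∧ ncClosure (restrict P X) = ⊤) ↔ _
  constructor
  · rintro ⟨hX, hoX, htop⟩ x
    constructor
    · intro hx
      rw [ncClosure_restrict_eq_top P fun x => gapLabel_eq_zero] at htop
      have h1 : ncClosure (onFiber P (gapLabel X) 0) ≤ onFiber (ncClosure P) (gapLabel X) 0 :=
        ncClosure_le ((noncrossing_ncClosure P).comap (Subtype.strictMono_coe _))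
          fun _ _ hP => le_ncClosure P hP
      rw [htop] at h1
      exact h1 (show (⊤ : Setoid _) ⟨o, gapLabel_eq_zero.2 hoX⟩ ⟨x, gapLabel_eq_zero.2 hx⟩
        from trivial)
    · intro h
      -- The gap labelling is noncrossing and coarser than `P`, hence coarser than the closure; so
      -- the closure class of `o` cannot leave `X`.
      have := ncClosure_le (noncrossing_ker_gapLabel X) hX.le_ker_gapLabel h
      exact gapLabel_eq_zero.1 (this.symm.trans (gapLabel_eq_zero.2 hoX))
  · intro hX
    refine ⟨?_, (hX o).2 ((ncClosure P).refl o), ?_⟩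
    · rintro x y ⟨a, b, c, hax, hbx, hcy, hac, hcb⟩ hy
      rw [hX] at hy ⊢
      have hco : ncClosure P c o :=
        (ncClosure P).trans (le_ncClosure P hcy) ((ncClosure P).symm hy)
      have hac := (noncrossing_ncClosure P).rel_of_mem_hull hac hcb (Or.inl (ho a))
        (le_ncClosure P (P.trans hax (P.symm hbx))) hco
      exact (ncClosure P).trans ((ncClosure P).symm hco)
        ((ncClosure P).trans ((ncClosure P).symm hac) (le_ncClosure P hax))
    · rw [ncClosure_restrict_eq_top P (l := Quotient.mk (ncClosure P)) (i := Quotient.mk _ o)]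
      · exact ((ncClosure_eq_iff (noncrossing_ncClosure P)).1 rfl).2 _
      · intro x
        rw [hX, eq_comm, Quotient.eq]

theorem sum_card_gap (X : Finset (Fin n)) :
    X.card + ∑ i ∈ Finset.range (X.card + 1), (gap X i).card = n := by
  have h := Finset.card_eq_sum_card_fiberwise (s := Xᶜ) (t := Finset.range (X.card + 1))
    (f := fun y => (X.filter (· < y)).card) fun y _ => by
      simpa using Nat.lt_succ_of_le (Finset.card_filter_le X _)
  have hgap : ∀ i, gap X i = Xᶜ.filter fun y => (X.filter (· < y)).card = i := fun i => by
    ext y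
    simp [gap]
  simp only [hgap]
  rw [← h, Finset.card_add_card_compl, Fintype.card_fin]

end Lowersets

/-! ## Multiplicativity over the factors of a multipartition -/

section Monomials

variable {K : Type*} [Field K] {F : PartitionClass}

/-- Families of subsets of the factors of the multipartition with list of factors `l`. -/
abbrev SubsetFamily (l : List (NonemptyPartition F)) : Type :=
  ∀ i : Fin l.length, Finset (Fin (l.get i).deg)

/-- The subset of the first factor. -/
def SubsetFamily.head {P : NonemptyPartition F} {l : List (NonemptyPartition F)}
    (X : SubsetFamily (P :: l)) : Finset (Fin P.deg) :=
  X ⟨0, Nat.succ_pos _⟩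

/-- The subsets of the other factors. -/
def SubsetFamily.tail {P : NonemptyPartition F} {l : List (NonemptyPartition F)}
    (X : SubsetFamily (P :: l)) : SubsetFamily l :=
  fun i => X i.succ

/-- The family with given subset of the first factor and the empty subset of the others. -/
def SubsetFamily.ofHead {P : NonemptyPartition F} (l : List (NonemptyPartition F))
    (Y : Finset (Fin P.deg)) : SubsetFamily (P :: l) :=
  fun i => match i with
    | ⟨0, _⟩ => Y
    | ⟨_ + 1, _⟩ => ∅

theorem SubsetFamily.ext_head_tail {P : NonemptyPartition F} {l : List (NonemptyPartition F)}
    {X Y : SubsetFamily (P :: l)} (h : X.head = Y.head) (h' : X.tail = Y.tail) : X = Y := by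
  funext i
  match i with
  | ⟨0, _⟩ => exact h
  | ⟨i + 1, hi⟩ => exact congrFun h' ⟨i, Nat.lt_of_succ_lt_succ hi⟩

/-- The product of the restrictions to the members of a family. -/
def lowerProd (l : List (NonemptyPartition F)) (X : SubsetFamily l) : Multipartition F :=
  (List.ofFn fun i => restrictMonomial (l.get i) (X i)).prod

/-- The product of the gap monomials of the members of a family. -/
def upperProd (l : List (NonemptyPartition F)) (X : SubsetFamily l) : Multipartition F :=
  (List.ofFn fun i => gapMonomial (l.get i) (X i)).prod

theorem lowerProd_cons (P : NonemptyPartition F) (l : List (NonemptyPartition F))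
    (X : SubsetFamily (P :: l)) :
    lowerProd (P :: l) X = restrictMonomial P X.head * lowerProd l X.tail :=
  (congrArg List.prod (List.ofFn_succ (n := l.length)
    (f := fun i => restrictMonomial ((P :: l).get i) (X i)))).trans List.prod_cons

theorem upperProd_cons (P : NonemptyPartition F) (l : List (NonemptyPartition F))
    (X : SubsetFamily (P :: l)) :
    upperProd (P :: l) X = gapMonomial P X.head * upperProd l X.tail :=
  (congrArg List.prod (List.ofFn_succ (n := l.length)
    (f := fun i => gapMonomial ((P :: l).get i) (X i)))).trans List.prod_cons

theorem lowerProd_nil (X : SubsetFamily ([] : List (NonemptyPartition F))) :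
    lowerProd [] X = 1 := rfl

theorem upperProd_nil (X : SubsetFamily ([] : List (NonemptyPartition F))) :
    upperProd [] X = 1 := rfl

theorem list_prod_map_range {M : Type*} [CommMonoid M] (f : ℕ → M) (n : ℕ) :
    ((List.range n).map f).prod = ∏ i ∈ Finset.range n, f i := by
  induction n with
  | zero => simp
  | succ n ih => simp [List.range_succ, Finset.prod_range_succ, ih]

/-- The total number of points of a multipartition. -/
def degree : Multipartition F →* Multiplicative ℕ :=
  FreeMonoid.lift fun P => Multiplicative.ofAdd P.deg

theorem degree_restrictMonomial (P : NonemptyPartition F) (X : Finset (Fin P.deg)) :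
    degree (restrictMonomial P X) = Multiplicative.ofAdd X.card := by
  unfold restrictMonomial
  split_ifs with h
  · simp [degree]
  · simp [Finset.not_nonempty_iff_eq_empty.1 h]

/-- A subset and its gaps partition the points; this conservation of points makes the induction in
`IsFixpoint.eq` well-founded. -/
theorem degree_restrict_mul_gap (P : NonemptyPartition F) (X : Finset (Fin P.deg)) :
    degree (restrictMonomial P X) * degree (gapMonomial P X) = Multiplicative.ofAdd P.deg := by
  rw [gapMonomial, map_list_prod, List.map_map, list_prod_map_range]
  simp only [Function.comp_def, degree_restrictMonomial]
  rw [← ofAdd_sum, ← ofAdd_add, sum_card_gap]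

theorem degree_lower_mul_upper (l : List (NonemptyPartition F)) (X : SubsetFamily l) :
    degree (lowerProd l X) * degree (upperProd l X) = degree (FreeMonoid.ofList l) := by
  induction l with
  | nil => rw [lowerProd_nil, upperProd_nil]; simp
  | cons P l ih =>
    rw [lowerProd_cons, upperProd_cons, FreeMonoid.ofList_cons, map_mul, map_mul, map_mul,
      mul_mul_mul_comm, ih, degree_restrict_mul_gap]
    rfl

theorem lowerProd_eq_one_iff (l : List (NonemptyPartition F)) (X : SubsetFamily l) :
    lowerProd l X = 1 ↔ X = fun _ => ∅ := by
  induction l with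
  | nil => exact ⟨fun _ => funext fun i => i.elim0, fun _ => rfl⟩
  | cons P l ih =>
    rw [lowerProd_cons]
    constructor
    · intro h
      have h1 := congrArg degree h
      rw [map_mul, map_one, degree_restrictMonomial, mul_eq_one] at h1
      have h0 : X.head = ∅ := Finset.card_eq_zero.1 h1.1
      refine SubsetFamily.ext_head_tail h0 ((ih _).1 ?_)
      simpa [restrictMonomial, h0] using h
    · rintro rfl
      rw [(ih (SubsetFamily.tail fun _ => ∅)).2 rfl, mul_one]
      exact dif_neg Finset.not_nonempty_empty

theorem degree_upperProd_lt (l : List (NonemptyPartition F)) (X : SubsetFamily l)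
    (h : 0 < l.length) (hX : (X ⟨0, h⟩).Nonempty) :
    (degree (upperProd l X)).toAdd < (degree (FreeMonoid.ofList l)).toAdd := by
  cases l with
  | nil => exact absurd h (by simp)
  | cons P l =>
    have h1 := congrArg Multiplicative.toAdd (degree_lower_mul_upper (P :: l) X)
    have h2 := congrArg Multiplicative.toAdd (congrArg degree (lowerProd_cons P l X))
    have h3 : 0 < X.head.card := Finset.card_pos.2 hX
    rw [map_mul, degree_restrictMonomial, toAdd_mul, toAdd_ofAdd] at h2
    rw [toAdd_mul] at h1
    omega

/-! ### Characters and their multiplicativity along cuts -/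

/-- The multiplicative linear form with `P ↦ a_P` on partitions. -/
def character (F : PartitionClass) (a : ℕ → K) : Hopf K F →ₐ[K] K :=
  MonoidAlgebra.lift K K (Multipartition F) (FreeMonoid.lift fun P => blockProd a P.part)

theorem character_of (a : ℕ → K) (P : NonemptyPartition F) :
    character F a (monomial K (FreeMonoid.of P)) = classProd a P.part := by
  simp [character, blockProd_eq_classProd]

theorem character_restrictMonomial (a : ℕ → K) (P : NonemptyPartition F)
    (X : Finset (Fin P.deg)) :
    character F a (monomial K (restrictMonomial P X)) = classProd a (restrict P.part X) := by
  unfold restrictMonomial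
  split_ifs with h
  · exact character_of a _
  · have : IsEmpty (Fin X.card) := by
      rw [Finset.not_nonempty_iff_eq_empty.1 h]
      exact Fin.isEmpty'
    rw [classProd_of_isEmpty, monomial, map_one, map_one]

theorem character_gapMonomial (a : ℕ → K) (P : NonemptyPartition F) (X : Finset (Fin P.deg)) :
    character F a (monomial K (gapMonomial P X)) =
      ∏ i ∈ Finset.range (X.card + 1), classProd a (restrict P.part (gap X i)) := by
  rw [gapMonomial, monomial, map_list_prod, map_list_prod, List.map_map, List.map_map,
    list_prod_map_range]
  exact Finset.prod_congr rfl fun i _ => character_restrictMonomial a P _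

theorem character_lower_mul_upper (a : ℕ → K) (l : List (NonemptyPartition F))
    (X : SubsetFamily l) (hX : ∀ i, IsLowerset (l.get i).part (X i)) :
    character F a (monomial K (lowerProd l X)) * character F a (monomial K (upperProd l X)) =
      character F a (monomial K (FreeMonoid.ofList l)) := by
  induction l with
  | nil =>
    rw [lowerProd_nil, upperProd_nil]
    simp only [monomial, FreeMonoid.ofList_nil, map_one, mul_one]
  | cons P l ih =>
    rw [lowerProd_cons, upperProd_cons, FreeMonoid.ofList_cons]
    simp only [monomial, map_mul]
    rw [mul_mul_mul_comm, ih X.tail fun i => hX i.succ, character_restrictMonomial,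
      character_gapMonomial, character_of,
      ← classProd_eq_restrict_mul_prod_gap a (P := P.part) (X := X.head)
        (hX ⟨0, Nat.succ_pos _⟩)]

end Monomials

/-! ## Fixpoint equations -/

section Fixpoints

variable {K : Type*} [Field K] {F : PartitionClass}

/-- The first element lies in the member of the family that belongs to the first factor. -/
def ContainsFirst (l : List (NonemptyPartition F)) (X : SubsetFamily l) : Prop :=
  ∃ h : 0 < l.length, (⟨0, (l.get ⟨0, h⟩).deg_pos⟩ : Fin (l.get ⟨0, h⟩).deg) ∈ X ⟨0, h⟩

open Classical in
/-- The cuts of a multipartition whose lowerset contains the first element. -/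
def firstCuts (l : List (NonemptyPartition F)) : Finset (SubsetFamily l) :=
  (Fintype.piFinset fun i => lowersets (l.get i).part).filter (ContainsFirst l)

theorem mem_firstCuts {l : List (NonemptyPartition F)} {X : SubsetFamily l} :
    X ∈ firstCuts l ↔ (∀ i, IsLowerset (l.get i).part (X i)) ∧ ContainsFirst l X := by
  simp [firstCuts, lowersets]

theorem linearForm_monomial (f : Multipartition F → K) (w : Multipartition F) :
    linearForm f (monomial K w) = f w := by
  have h : monomial K w = MonoidAlgebra.basis (Multipartition F) K w := by simp
  rw [linearForm, h, Module.Basis.constr_basis]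

theorem dual_ext {f g : Module.Dual K (Hopf K F)}
    (h : ∀ w, f (monomial K w) = g (monomial K w)) : f = g :=
  (MonoidAlgebra.basis (Multipartition F) K).ext fun w => by simpa using h w

theorem counit_monomial_one : counit K F (monomial K 1) = 1 := by
  rw [counit, linearForm_monomial, if_pos rfl]

theorem counit_monomial_of_ne_one {w : Multipartition F} (hw : w ≠ 1) :
    counit K F (monomial K w) = 0 := by
  rw [counit, linearForm_monomial, if_neg hw]

theorem prec_monomial (f g : Module.Dual K (Hopf K F)) (w : Multipartition F) :
    prec f g (monomial K w) = ∑ X ∈ firstCuts w.toList,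
      f (monomial K (lowerProd w.toList X)) * g (monomial K (upperProd w.toList X)) := by
  have h : monomial K w = MonoidAlgebra.basis (Multipartition F) K w := by simp
  rw [prec, LinearMap.comp_apply, LinearMap.comp_apply, deltaPrec, h, Module.Basis.constr_basis,
    map_sum, map_sum]
  exact Finset.sum_congr rfl fun X _ => rfl

/-- A fixpoint equation has at most one solution. -/
theorem IsFixpoint.eq {α f g : Module.Dual K (Hopf K F)} (hf : IsFixpoint α f)
    (hg : IsFixpoint α g) : f = g := by
  refine dual_ext fun w => ?_
  induction h : (degree w).toAdd using Nat.strong_induction_on generalizing w with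
  | _ d ih =>
    rw [hf, hg, LinearMap.add_apply, LinearMap.add_apply, prec_monomial, prec_monomial]
    congr 1
    refine Finset.sum_congr rfl fun X hX => ?_
    obtain ⟨-, h0, hX⟩ := mem_firstCuts.1 hX
    have hlt := degree_upperProd_lt w.toList X h0 ⟨_, hX⟩
    rw [FreeMonoid.ofList_toList, h] at hlt
    rw [ih _ hlt _ rfl]

/-- The linear form with value `a_P` on the partitions `P` whose noncrossing closure has a single
block, and `0` on all other multipartitions. -/
def connectedForm (F : PartitionClass) (a : ℕ → K) : Module.Dual K (Hopf K F) :=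
  open Classical in
  linearForm fun w =>
    match w.toList with
    | [P] => if nc P.part = ⊤ then blockProd a P.part else 0
    | _ => 0

open Classical in
theorem connectedForm_of (a : ℕ → K) (P : NonemptyPartition F) :
    connectedForm F a (monomial K (FreeMonoid.of P)) =
      if nc P.part = ⊤ then classProd a P.part else 0 := by
  rw [connectedForm, linearForm_monomial, ← blockProd_eq_classProd]
  rfl

theorem connectedForm_of_mul (a : ℕ → K) (P : NonemptyPartition F) {w : Multipartition F}
    (hw : w ≠ 1) : connectedForm F a (monomial K (FreeMonoid.of P * w)) = 0 := by
  rw [connectedForm, linearForm_monomial]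
  cases w using FreeMonoid.casesOn with
  | one => exact absurd rfl hw
  | of_mul Q w => rfl

theorem restrictMonomial_of_nonempty (P : NonemptyPartition F) {X : Finset (Fin P.deg)}
    (h : X.Nonempty) : restrictMonomial P X =
      FreeMonoid.of ⟨X.card, X.card_pos.2 h, restrict P.part X, F.restrict_mem _ _ P.mem⟩ :=
  dif_pos h

open Classical in
theorem sum_firstCuts_connectedForm (a : ℕ → K) (P : NonemptyPartition F)
    (l : List (NonemptyPartition F)) :
    ∑ X ∈ firstCuts (P :: l), connectedForm F a (monomial K (lowerProd (P :: l) X)) *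
      character F a (monomial K (upperProd (P :: l) X)) =
        character F a (monomial K (FreeMonoid.ofList (P :: l))) := by
  let o : Fin P.deg := ⟨0, P.deg_pos⟩
  have ho : ∀ x, o ≤ x := fun x => Nat.zero_le _
  -- The first class of the closure of `P`, extended by empty lowersets on the other factors, is the
  -- only cut that contributes.
  let Y : Finset (Fin P.deg) := Finset.univ.filter (ncClosure P.part o)
  have hY : ∀ x, x ∈ Y ↔ ncClosure P.part o x := fun x => by simp [Y]
  obtain ⟨hYl, hoY, hYtop⟩ := (isLowerset_connected_iff ho).2 hY
  let X₀ : SubsetFamily (P :: l) := SubsetFamily.ofHead l Y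
  have hX₀ : X₀ ∈ firstCuts (P :: l) := by
    refine mem_firstCuts.2 ⟨?_, Nat.succ_pos _, hoY⟩
    rintro ⟨_ | i, hi⟩
    · exact hYl
    · exact isLowerset_empty _
  have htail : lowerProd l X₀.tail = 1 := (lowerProd_eq_one_iff l _).2 rfl
  rw [Finset.sum_eq_single_of_mem X₀ hX₀]
  · rw [← character_lower_mul_upper a (P :: l) X₀ (mem_firstCuts.1 hX₀).1, lowerProd_cons, htail,
      mul_one, restrictMonomial_of_nonempty P (X := X₀.head) ⟨o, hoY⟩, connectedForm_of,
      character_of]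
    exact congrArg (· * _) (if_pos hYtop)
  · intro X hX hne
    obtain ⟨hlow, h0, hoX⟩ := mem_firstCuts.1 hX
    refine mul_eq_zero_of_left ?_ _
    rw [lowerProd_cons, restrictMonomial_of_nonempty P (X := X.head) ⟨o, hoX⟩]
    -- If the tail is nontrivial, the lower monomial has at least two factors and the form vanishes.
    -- Otherwise a nonzero value would force `X = X₀`.
    by_cases h1 : lowerProd l X.tail = 1
    · rw [h1, mul_one, connectedForm_of]
      refine if_neg fun htop => hne ?_
      refine SubsetFamily.ext_head_tail ?_ ((lowerProd_eq_one_iff l _).1 h1)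
      ext x
      rw [(isLowerset_connected_iff (P := P.part) (X := X.head) ho).1 ⟨hlow ⟨0, Nat.succ_pos _⟩, hoX, htop⟩ x]
      exact (hY x).symm
    · exact connectedForm_of_mul a _ h1

theorem isFixpoint_character (F : PartitionClass) (a : ℕ → K) :
    IsFixpoint (connectedForm F a) (character F a).toLinearMap := by
  refine dual_ext fun w => ?_
  rw [LinearMap.add_apply, prec_monomial]
  cases w using FreeMonoid.casesOn with
  | one =>
    rw [counit_monomial_one, Finset.sum_eq_zero, add_zero]
    · simp only [monomial, AlgHom.toLinearMap_apply, map_one]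
    · intro X hX
      obtain ⟨-, h, -⟩ := mem_firstCuts.1 hX
      exact absurd h (by simp)
  | of_mul P w =>
    rw [counit_monomial_of_ne_one (by
      intro h
      simpa using congrArg FreeMonoid.length h), zero_add]
    exact (sum_firstCuts_connectedForm a P w.toList).symm

theorem classicalForm_eq_connectedForm (c : ℕ → K) : classicalForm c = connectedForm SP c := by
  refine dual_ext fun w => ?_
  rw [classicalForm, connectedForm, linearForm_monomial, linearForm_monomial]
  split <;> simp [*]

/-- A noncrossing partition is its own closure, so one-block closure means one block, and then the
block product is a single `k_n`. -/
theorem freeForm_eq_connectedForm (k : ℕ → K) : freeForm k = connectedForm NCP k := by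
  classical
  refine dual_ext fun w => ?_
  rw [freeForm, connectedForm, linearForm_monomial, linearForm_monomial]
  have key : ∀ Q : NonemptyPartition NCP, (if Q.part = ⊤ then k Q.deg else 0) =
      if nc Q.part = ⊤ then blockProd k Q.part else 0 := by
    intro Q
    have hQ : nc Q.part = Q.part := Noncrossing.ncClosure_eq Q.mem
    have : Nonempty (Fin Q.deg) := ⟨⟨0, Q.deg_pos⟩⟩
    rw [hQ]
    split_ifs with h
    · rw [h, blockProd_eq_classProd, classProd_top, Nat.card_fin]
    · rfl
  split <;> simp [*]

/-- Blocks are nonempty, so the unconstrained value of a weight at `0` plays no role. -/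
theorem classProd_congr_of_pos {ι : Type*} [Finite ι] {a b : ℕ → K} (h : ∀ n, 0 < n → a n = b n)
    (P : Setoid ι) : classProd a P = classProd b P := by
  refine finprod_congr fun π => h _ ?_
  obtain ⟨x, rfl⟩ := Quotient.exists_rep π
  have : Nonempty {y // Quotient.mk P y = Quotient.mk P x} := ⟨⟨x, rfl⟩⟩
  exact Nat.card_pos

/-- Both sides are algebra morphisms on a free algebra, so it suffices to compare them on single
noncrossing partitions. -/
theorem character_comp_ncStar [CharZero K] {m k : ℕ → K} (hk : IsFreeCumulants m k) :
    (character SP (classicalCumulant m)).comp (ncStar K) = character NCP k := by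
  classical
  refine MonoidAlgebra.algHom_ext' (FreeMonoid.hom_eq fun Q => ?_) (Subsingleton.elim _ _)
  change character SP (classicalCumulant m) (ncStar K (monomial K (FreeMonoid.of Q))) =
    character NCP k (monomial K (FreeMonoid.of Q))
  have h := sum_ncClosure_eq (classicalCumulant m) (Q := Q.part) Q.mem
  rw [character_of, classProd_congr_of_pos (fun n hn => freeCumulant_eq_connectedSum hk hn), ← h,
    ncStar, monomial, MonoidAlgebra.lift_of, FreeMonoid.lift_eval_of, map_sum]
  refine Finset.sum_congr (by congr!) fun P _ => ?_
  exact character_of _ _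

end Fixpoints

end GapInsertion

end

theorem mainTheorem12 {K : Type*} [Field K] [CharZero K] (m k : ℕ → K)
    (hk : GapInsertion.IsFreeCumulants m k) :
    -- each of the two fixpoint equations has exactly one solution
    (∃! φ : Module.Dual K (GapInsertion.Hopf K GapInsertion.NCP),
      GapInsertion.IsFixpoint (GapInsertion.freeForm k) φ) ∧
    (∃! ψ : Module.Dual K (GapInsertion.Hopf K GapInsertion.SP),
      GapInsertion.IsFixpoint
        (GapInsertion.classicalForm (GapInsertion.classicalCumulant m)) ψ) ∧
    ∀ (φ : Module.Dual K (GapInsertion.Hopf K GapInsertion.NCP))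
      (ψ : Module.Dual K (GapInsertion.Hopf K GapInsertion.SP)),
      GapInsertion.IsFixpoint (GapInsertion.freeForm k) φ →
      GapInsertion.IsFixpoint
        (GapInsertion.classicalForm (GapInsertion.classicalCumulant m)) ψ →
      φ = ψ ∘ₗ (GapInsertion.ncStar K).toLinearMap ∧
      -- on partitions this specializes to `k = c ∘ nc*`
      (∀ Q : GapInsertion.NonemptyPartition GapInsertion.NCP,
        φ (GapInsertion.monomial K (FreeMonoid.of Q)) = GapInsertion.blockProd k Q.part) ∧
      (∀ P : GapInsertion.NonemptyPartition GapInsertion.SP,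
        ψ (GapInsertion.monomial K (FreeMonoid.of P)) =
          GapInsertion.blockProd (GapInsertion.classicalCumulant m) P.part) ∧
      (∀ (n : ℕ) (hn : 0 < n),
        m n = ∑ P : GapInsertion.SetPartition n,
          ψ (GapInsertion.monomial K (FreeMonoid.of (GapInsertion.genSP hn P)))) := by
  rw [GapInsertion.freeForm_eq_connectedForm, GapInsertion.classicalForm_eq_connectedForm]
  have hφ := GapInsertion.isFixpoint_character GapInsertion.NCP k
  have hψ := GapInsertion.isFixpoint_character GapInsertion.SP (GapInsertion.classicalCumulant m)
  refine ⟨⟨_, hφ, fun f hf => hf.eq hφ⟩, ⟨_, hψ, fun f hf => hf.eq hψ⟩, ?_⟩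
  intro φ ψ hφ' hψ'
  -- Uniqueness replaces arbitrary solutions by the characters; what remains are evaluations.
  obtain rfl := hφ'.eq hφ
  obtain rfl := hψ'.eq hψ
  refine ⟨?_, fun Q => ?_, fun P => ?_, fun n hn => ?_⟩
  · rw [← GapInsertion.character_comp_ncStar hk, AlgHom.comp_toLinearMap]
  · rw [GapInsertion.blockProd_eq_classProd]
    exact GapInsertion.character_of k Q
  · rw [GapInsertion.blockProd_eq_classProd]
    exact GapInsertion.character_of _ P
  · rw [GapInsertion.moment_eq_sum_classicalCumulant m hn, GapInsertion.setoidSum]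
    exact Finset.sum_congr rfl fun P _ => 
      (GapInsertion.character_of (F := GapInsertion.SP) _ (GapInsertion.genSP hn P)).symm
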